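/- Let $k$ be an algebraically closed field of characteristic zero; all algebraic groups are linear algebraic groups over $k$. For a connected linear algebraic group $G$ with Lie algebra $\mathfrak g$, a generalized Cayley map of $G$ is a dominant rational map $\varphi\colon G\dashrightarrow\mathfrak g$ that is equivariant with respect to the conjugation action of $G$ on itself and the adjoint action of $G$ on $\mathfrak g$; its degree is $\deg\varphi=[k(G):\varphi^*(k(\mathfrak g))]$. The Cayley degree $\operatorname{Cay}(G)$ is the minimal value of $\deg\varphi$ over all generalized Cayley maps $\varphi$ of $G$, and $G$ is called Cayley if there is an equivariant birational isomorphism $G\dashrightarrow\mathfrak g$. (a) Let $\pi\colon G\to H$ be an isogeny (a surjective homomorphism of algebraic groups with finite kernel) between connected linear algebraic groups and let $d$ be the order of its kernel. (a$_1$) Then $\operatorname{Cay}(G)\le d\cdot\operatorname{Cay}(H)$. (a$_2$) If $G$ is not Cayley but $H$ is Cayley, and $d=2$, then $\operatorname{Cay}(G)=2$. (b) Let $\varphi_i$ be a generalized Cayley map of a connected linear algebraic group $G_i$, where $i=1,\dots,n$. Then $\varphi_1\times\dots\times\varphi_n$ is a generalized Cayley map of $G_1\times\dots\times G_n$, and $$\deg(\varphi_1\times\dots\times\varphi_n)=\deg\varphi_1\cdots\deg\varphi_n.$$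 -/

import Mathlib

namespace CayleyDeg

universe u v w

/-! ### Affine varieties and linear algebraic groups

Classical language: a variety is the set of its `k`-points together with its algebra of regular
functions. -/

section Variety

/-- The structure of an affine variety on a set `X` (intended for algebraically closed `k`):
a finitely generated algebra `k[X]` of `k`-valued functions on `X` such that `X` is, via
evaluation, the set of all `k`-algebra homomorphisms `k[X] → k`. -/
class AffineVariety (k : Type u) [Field k] (X : Type v) where
  /-- the algebra `k[X]` of regular functions -/
  coord : Subalgebra k (X → k)
  fg : coord.FG
  eval_bijective : Function.Bijective
    (fun x : X => ((Pi.evalAlgHom k (fun _ : X => k) x).comp coord.val : coord →ₐ[k] k))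

variable (k : Type u) [Field k]

/-- The algebra `k[X]` of regular functions on an affine variety `X`. -/
abbrev coord (X : Type v) [AffineVariety k X] : Subalgebra k (X → k) := AffineVariety.coord

/-- The algebra of regular functions on the product variety `X × Y`, that is
`k[X] ⊗ k[Y]` viewed as functions on `X × Y`: it is generated by the functions
`(x, y) ↦ f x` and `(x, y) ↦ h y` with `f`, `h` regular. -/
def prodCoord (X : Type v) (Y : Type w) [AffineVariety k X] [AffineVariety k Y] :
    Subalgebra k (X × Y → k) :=
  Algebra.adjoin k ({F | ∃ f ∈ coord k X, F = fun p => f p.1} ∪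
    {F | ∃ h ∈ coord k Y, F = fun p => h p.2})

/-- Morphisms of affine varieties: maps that pull regular functions back to regular functions. -/
def IsRegular {X : Type v} {Y : Type w} [AffineVariety k X] [AffineVariety k Y] (f : X → Y) :
    Prop :=
  ∀ h ∈ coord k Y, h ∘ f ∈ coord k X

/-- The Zariski topology, generated by the principal open sets `{x | f x ≠ 0}`, `f ∈ k[X]`. -/
@[reducible]
def zariski (X : Type v) [AffineVariety k X] : TopologicalSpace X :=
  TopologicalSpace.generateFrom {U | ∃ f ∈ coord k X, U = {x | f x ≠ 0}}

/-- `X` is connected in the Zariski topology. -/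
class ZariskiConnected (X : Type v) [AffineVariety k X] : Prop where
  connected : @ConnectedSpace X (zariski k X)

/-- A linear (equivalently, affine) algebraic group: a group which is an affine variety such that
multiplication `G × G → G` and inversion `G → G` are morphisms of varieties. -/
class LinearAlgebraicGroup (G : Type v) [Group G] extends AffineVariety k G where
  mul_regular : ∀ f ∈ coord, (fun p : G × G => f (p.1 * p.2)) ∈ prodCoord k G G
  inv_regular : ∀ f ∈ coord, (fun x : G => f x⁻¹) ∈ coord

/-- The field of rational functions `k(X)` of a variety `X`
(a field as soon as `k[X]` is a domain). -/
abbrev FunField (X : Type v) [AffineVariety k X] : Type (max u v) := FractionRing (coord k X)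

variable {k}

/-- The comorphism `k[Y] → k[X]` of a morphism `X → Y`. -/
def IsRegular.comap {X : Type v} {Y : Type w} [AffineVariety k X] [AffineVariety k Y] {f : X → Y}
    (hf : IsRegular k f) : coord k Y →ₐ[k] coord k X where
  toFun h := ⟨h.1 ∘ f, hf h.1 h.2⟩
  map_one' := rfl
  map_mul' _ _ := rfl
  map_zero' := rfl
  map_add' _ _ := rfl
  commutes' _ := rfl

theorem IsRegular.comap_injective {X : Type v} {Y : Type w} [AffineVariety k X]
    [AffineVariety k Y] {f : X → Y} (hf : IsRegular k f) (hs : Function.Surjective f) :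
    Function.Injective hf.comap := by
  intro a b hab
  apply Subtype.ext
  funext y
  obtain ⟨x, rfl⟩ := hs y
  exact congrFun (congrArg Subtype.val hab) x

theorem IsRegular.continuous {X : Type v} {Y : Type w} [AffineVariety k X] [AffineVariety k Y]
    {f : X → Y} (hf : IsRegular k f) : @Continuous X Y (zariski k X) (zariski k Y) f := by
  let _ := zariski k X
  refine continuous_generateFrom_iff.2 ?_
  rintro U ⟨h, hh, rfl⟩
  exact TopologicalSpace.isOpen_generateFrom_of_mem ⟨h ∘ f, hf h hh, rfl⟩

end Variety

/-! ### The coordinate ring of a connected linear algebraic group is a domain -/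

section Domain

theorem isPreirreducible_univ_of_homogeneous {X : Type v} [TopologicalSpace X]
    [TopologicalSpace.NoetherianSpace X] [ConnectedSpace X]
    (hom : ∀ x y : X, ∃ h : X ≃ₜ X, h x = y) : IsPreirreducible (Set.univ : Set X) := by
  obtain ⟨x₀⟩ := (inferInstance : Nonempty X)
  have hC := irreducibleComponent_mem_irreducibleComponents x₀
  obtain ⟨U, hU, ⟨z, hz⟩, hUC⟩ :=
    TopologicalSpace.NoetherianSpace.exists_isOpen_nonempty_subset_irreducibleComponent _ hC
  have hcl : IsClosed (irreducibleComponent x₀) := isClosed_irreducibleComponent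
  have hopen : IsOpen (irreducibleComponent x₀) := by
    rw [isOpen_iff_mem_nhds]
    intro y hy
    obtain ⟨h, hh⟩ := hom z y
    have hyU : y ∈ h '' U := ⟨z, hz, hh⟩
    have hV : IsOpen (h '' U) := h.isOpenMap U hU
    have hD : IsIrreducible (h '' irreducibleComponent x₀) :=
      isIrreducible_irreducibleComponent.image h h.continuous.continuousOn
    have hsub : irreducibleComponent x₀ ⊆ closure (h '' irreducibleComponent x₀) := by
      intro t ht
      rw [mem_closure_iff]
      intro W hW htW
      obtain ⟨s, -, hsV, hsW⟩ :=
        (irreducibleComponent_property x₀).1 _ _ hV hW ⟨y, hy, hyU⟩ ⟨t, ht, htW⟩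
      exact ⟨s, hsW, Set.image_mono hUC hsV⟩
    have heq := eq_irreducibleComponent hD.closure.isPreirreducible hsub
    refine Filter.mem_of_superset (hV.mem_nhds hyU) ?_
    rw [← heq]
    exact (Set.image_mono hUC).trans subset_closure
  have huniv : irreducibleComponent x₀ = Set.univ :=
    IsClopen.eq_univ ⟨hcl, hopen⟩ ⟨x₀, mem_irreducibleComponent⟩
  rw [← huniv]
  exact (irreducibleComponent_property x₀).1

variable (k : Type u) [Field k]

theorem zariski_noetherian (X : Type v) [AffineVariety k X] :
    @TopologicalSpace.NoetherianSpace X (zariski k X) := by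
  letI := zariski k X
  have : Algebra.FiniteType k (coord k X) :=
    (Subalgebra.fg_iff_finiteType _).1 AffineVariety.fg
  have : IsNoetherianRing (coord k X) := Algebra.FiniteType.isNoetherianRing k _
  let ev : X → (coord k X →+* k) := fun x =>
    ((Pi.evalAlgHom k (fun _ : X => k) x).comp (coord k X).val).toRingHom
  let i : X → PrimeSpectrum (coord k X) := fun x => ⟨RingHom.ker (ev x), RingHom.ker_isPrime _⟩
  have hi : Topology.IsInducing i := by
    constructor
    rw [PrimeSpectrum.isTopologicalBasis_basic_opens.eq_generateFrom, induced_generateFrom_eq]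
    change TopologicalSpace.generateFrom _ = _
    congr 1
    ext U
    constructor
    · rintro ⟨f, hf, rfl⟩
      exact ⟨_, ⟨⟨f, hf⟩, rfl⟩, rfl⟩
    · rintro ⟨_, ⟨f, rfl⟩, rfl⟩
      exact ⟨f.1, f.2, rfl⟩
  exact hi.noetherianSpace

variable {k} {G : Type v} [Group G] [LinearAlgebraicGroup k G]

theorem slice_left {F : G × G → k} (hF : F ∈ prodCoord k G G) (g : G) :
    (fun x => F (g, x)) ∈ coord k G := by
  induction hF using Algebra.adjoin_induction with
  | mem F hF =>
    rcases hF with ⟨f, -, rfl⟩ | ⟨f, hf, rfl⟩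
    · exact (coord k G).algebraMap_mem (f g)
    · exact hf
  | algebraMap r => exact (coord k G).algebraMap_mem r
  | add _ _ _ _ h₁ h₂ => exact (coord k G).add_mem h₁ h₂
  | mul _ _ _ _ h₁ h₂ => exact (coord k G).mul_mem h₁ h₂

theorem slice_right {F : G × G → k} (hF : F ∈ prodCoord k G G) (g : G) :
    (fun x => F (x, g)) ∈ coord k G := by
  induction hF using Algebra.adjoin_induction with
  | mem F hF =>
    rcases hF with ⟨f, hf, rfl⟩ | ⟨f, -, rfl⟩
    · exact hf
    · exact (coord k G).algebraMap_mem (f g)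
  | algebraMap r => exact (coord k G).algebraMap_mem r
  | add _ _ _ _ h₁ h₂ => exact (coord k G).add_mem h₁ h₂
  | mul _ _ _ _ h₁ h₂ => exact (coord k G).mul_mem h₁ h₂

theorem regular_mul_left (g : G) : IsRegular k (fun x : G => g * x) := fun f hf =>
  slice_left (LinearAlgebraicGroup.mul_regular f hf) g

theorem regular_mul_right (g : G) : IsRegular k (fun x : G => x * g) := fun f hf =>
  slice_right (LinearAlgebraicGroup.mul_regular f hf) g

theorem regular_conj (g : G) : IsRegular k (MulAut.conj g).toMonoidHom := fun f hf =>
  regular_mul_left g _ (regular_mul_right g⁻¹ f hf)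

instance isDomain_coord [ZariskiConnected k G] : IsDomain (coord k G) := by
  letI := zariski k G
  have := zariski_noetherian k G
  have : ConnectedSpace G := ZariskiConnected.connected (k := k)
  have hirr : IsPreirreducible (Set.univ : Set G) := by
    refine isPreirreducible_univ_of_homogeneous fun x y => ?_
    refine ⟨⟨Equiv.mulLeft (y * x⁻¹), (regular_mul_left (k := k) _).continuous,
      (regular_mul_left (k := k) _).continuous⟩, ?_⟩
    change y * x⁻¹ * x = y
    simp
  have : Nontrivial (coord k G) := by
    refine ⟨0, 1, fun h => ?_⟩
    exact zero_ne_one (congrFun (congrArg Subtype.val h) 1)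
  have : NoZeroDivisors (coord k G) := by
    refine ⟨fun {a b} hab => ?_⟩
    by_contra! hne
    obtain ⟨x, hx⟩ : ∃ x, a.1 x ≠ 0 := by
      by_contra! h
      exact hne.1 (Subtype.ext (funext h))
    obtain ⟨y, hy⟩ : ∃ x, b.1 x ≠ 0 := by
      by_contra! h
      exact hne.2 (Subtype.ext (funext h))
    obtain ⟨z, -, hz₁, hz₂⟩ := hirr {x | a.1 x ≠ 0} {x | b.1 x ≠ 0}
      (TopologicalSpace.isOpen_generateFrom_of_mem ⟨a.1, a.2, rfl⟩)
      (TopologicalSpace.isOpen_generateFrom_of_mem ⟨b.1, b.2, rfl⟩)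
      ⟨x, trivial, hx⟩ ⟨y, trivial, hy⟩
    exact (mul_ne_zero hz₁ hz₂) (congrFun (congrArg Subtype.val hab) z)
  exact NoZeroDivisors.to_isDomain _

end Domain

/-! ### Finite products of linear algebraic groups -/

section Product

variable {k : Type u} [Field k] {ι : Type w} [Finite ι]

/-- The product of finitely many affine varieties: its regular functions are generated by the
functions `x ↦ h (x i)` with `h` regular on the `i`-th factor. -/
instance piVariety (X : ι → Type v) [∀ i, AffineVariety k (X i)] :
    AffineVariety k (∀ i, X i) where
  coord := Algebra.adjoin k {F | ∃ i, ∃ h ∈ coord k (X i), F = fun x => h (x i)}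
  fg := by
    choose t ht using fun i => Subalgebra.fg_def.1 (AffineVariety.fg (k := k) (X := X i))
    rw [Subalgebra.fg_def]
    refine ⟨⋃ i, (fun h : X i → k => fun x : ∀ i, X i => h (x i)) '' t i,
      Set.finite_iUnion fun i => (ht i).1.image _, ?_⟩
    apply le_antisymm
    · refine Algebra.adjoin_mono ?_
      intro F hF
      obtain ⟨i, h, hh, rfl⟩ := Set.mem_iUnion.1 hF
      refine ⟨i, h, ?_, rfl⟩
      change h ∈ AffineVariety.coord
      rw [← (ht i).2]
      exact Algebra.subset_adjoin hh
    · refine Algebra.adjoin_le ?_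
      rintro F ⟨i, h, hh, rfl⟩
      change h ∈ AffineVariety.coord at hh
      rw [← (ht i).2] at hh
      induction hh using Algebra.adjoin_induction with
      | mem h hh => exact Algebra.subset_adjoin (Set.mem_iUnion.2 ⟨i, h, hh, rfl⟩)
      | algebraMap r => exact Subalgebra.algebraMap_mem _ r
      | add _ _ _ _ h₁ h₂ => exact Subalgebra.add_mem _ h₁ h₂
      | mul _ _ _ _ h₁ h₂ => exact Subalgebra.mul_mem _ h₁ h₂
  eval_bijective := by
    constructor
    · intro x y hxy
      funext i
      apply (AffineVariety.eval_bijective (k := k) (X := X i)).1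
      ext ⟨h, hh⟩
      exact DFunLike.congr_fun hxy ⟨fun x => h (x i), Algebra.subset_adjoin ⟨i, h, hh, rfl⟩⟩
    · intro χ
      let p : ∀ i, coord k (X i) →ₐ[k] (Algebra.adjoin k
          {F : (∀ i, X i) → k | ∃ i, ∃ h ∈ coord k (X i), F = fun x => h (x i)}) := fun i =>
        { toFun := fun h => ⟨fun x => h.1 (x i), Algebra.subset_adjoin ⟨i, h.1, h.2, rfl⟩⟩
          map_one' := rfl
          map_mul' := fun _ _ => rfl
          map_zero' := rfl
          map_add' := fun _ _ => rfl
          commutes' := fun _ => rfl }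
      choose x hx using fun i =>
        (AffineVariety.eval_bijective (k := k) (X := X i)).2 (χ.comp (p i))
      refine ⟨x, ?_⟩
      ext ⟨F, hF⟩
      induction hF using Algebra.adjoin_induction with
      | mem F hF =>
        obtain ⟨i, h, hh, rfl⟩ := hF
        exact DFunLike.congr_fun (hx i) ⟨h, hh⟩
      | algebraMap r => exact (χ.commutes r).symm
      | add a b ha hb h₁ h₂ =>
        exact (congrArg₂ (· + ·) h₁ h₂).trans (χ.map_add ⟨a, ha⟩ ⟨b, hb⟩).symm
      | mul a b ha hb h₁ h₂ =>
        exact (congrArg₂ (· * ·) h₁ h₂).trans (χ.map_mul ⟨a, ha⟩ ⟨b, hb⟩).symm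

theorem regular_proj (X : ι → Type v) [∀ i, AffineVariety k (X i)] (i : ι) :
    IsRegular k (fun x : ∀ i, X i => x i) := fun h hh =>
  Algebra.subset_adjoin ⟨i, h, hh, rfl⟩

theorem regular_update [DecidableEq ι] (X : ι → Type v) [∀ i, AffineVariety k (X i)] (i : ι)
    (x : ∀ i, X i) : IsRegular k (fun t : X i => Function.update x i t) := by
  intro F hF
  change F ∈ Algebra.adjoin k _ at hF
  induction hF using Algebra.adjoin_induction with
  | mem F hF =>
    obtain ⟨j, h, hh, rfl⟩ := hF
    by_cases hij : j = i
    · subst hij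
      have : (fun x : ∀ i, X i => h (x j)) ∘ (fun t => Function.update x j t) = h := by
        funext t
        simp
      rw [this]
      exact hh
    · have : (fun x : ∀ i, X i => h (x j)) ∘ (fun t => Function.update x i t) =
          algebraMap k (X i → k) (h (x j)) := by
        funext t
        simp [Function.update_of_ne hij]
      rw [this]
      exact Subalgebra.algebraMap_mem _ _
  | algebraMap r => exact Subalgebra.algebraMap_mem _ r
  | add _ _ _ _ h₁ h₂ => exact Subalgebra.add_mem _ h₁ h₂
  | mul _ _ _ _ h₁ h₂ => exact Subalgebra.mul_mem _ h₁ h₂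

/-- The direct product of finitely many linear algebraic groups. -/
instance piGroup (G : ι → Type v) [∀ i, Group (G i)] [∀ i, LinearAlgebraicGroup k (G i)] :
    LinearAlgebraicGroup k (∀ i, G i) where
  mul_regular := by
    intro F hF
    change F ∈ Algebra.adjoin k _ at hF
    induction hF using Algebra.adjoin_induction with
    | mem F hF =>
      obtain ⟨i, h, hh, rfl⟩ := hF
      have key : ∀ E ∈ prodCoord k (G i) (G i),
          (fun p : (∀ i, G i) × (∀ i, G i) => E (p.1 i, p.2 i)) ∈
            prodCoord k (∀ i, G i) (∀ i, G i) := by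
        intro E hE
        induction hE using Algebra.adjoin_induction with
        | mem E hE =>
          rcases hE with ⟨f, hf, rfl⟩ | ⟨f, hf, rfl⟩
          · exact Algebra.subset_adjoin (Or.inl ⟨_, regular_proj G i f hf, rfl⟩)
          · exact Algebra.subset_adjoin (Or.inr ⟨_, regular_proj G i f hf, rfl⟩)
        | algebraMap r => exact Subalgebra.algebraMap_mem _ r
        | add _ _ _ _ h₁ h₂ => exact Subalgebra.add_mem _ h₁ h₂
        | mul _ _ _ _ h₁ h₂ => exact Subalgebra.mul_mem _ h₁ h₂
      exact key _ (LinearAlgebraicGroup.mul_regular h hh)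
    | algebraMap r => exact Subalgebra.algebraMap_mem _ r
    | add _ _ _ _ h₁ h₂ => exact Subalgebra.add_mem _ h₁ h₂
    | mul _ _ _ _ h₁ h₂ => exact Subalgebra.mul_mem _ h₁ h₂
  inv_regular := by
    intro F hF
    change F ∈ Algebra.adjoin k _ at hF
    induction hF using Algebra.adjoin_induction with
    | mem F hF =>
      obtain ⟨i, h, hh, rfl⟩ := hF
      exact regular_proj G i _ (LinearAlgebraicGroup.inv_regular h hh)
    | algebraMap r => exact Subalgebra.algebraMap_mem _ r
    | add _ _ _ _ h₁ h₂ => exact Subalgebra.add_mem _ h₁ h₂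
    | mul _ _ _ _ h₁ h₂ => exact Subalgebra.mul_mem _ h₁ h₂

/-- A finite product of connected varieties is connected. -/
instance piConnected (X : ι → Type v) [∀ i, AffineVariety k (X i)]
    [∀ i, ZariskiConnected k (X i)] : ZariskiConnected k (∀ i, X i) where
  connected := by
    classical
    letI := zariski k (∀ i, X i)
    letI : ∀ i, TopologicalSpace (X i) := fun i => zariski k (X i)
    have : ∀ i, ConnectedSpace (X i) := fun i => ZariskiConnected.connected (k := k)
    have := Fintype.ofFinite ι
    rw [connectedSpace_iff_connectedComponent]
    have x : ∀ i, X i := fun i => Classical.arbitrary _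
    refine ⟨x, Set.eq_univ_of_forall fun y => ?_⟩
    have key : ∀ s : Finset ι, (fun i => if i ∈ s then y i else x i) ∈ connectedComponent x := by
      intro s
      induction s using Finset.induction_on with
      | empty =>
        have : (fun i => if i ∈ (∅ : Finset ι) then y i else x i) = x := by
          funext i
          simp
        rw [this]
        exact mem_connectedComponent
      | insert a s ha ih =>
        rw [connectedComponent_eq ih]
        set z : ∀ i, X i := fun i => if i ∈ s then y i else x i with hz
        have hc : Continuous (fun t : X a => Function.update z a t) :=
          (regular_update (k := k) X a z).continuous
        have hr := (isPreconnected_range hc).subset_connectedComponent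
          (x := z) ⟨z a, Function.update_eq_self a z⟩
        apply hr
        refine ⟨y a, ?_⟩
        funext i
        by_cases hi : i = a
        · subst hi
          simp
        · simp [hz, hi]
    simpa using key Finset.univ

theorem regular_single [DecidableEq ι] (G : ι → Type v) [∀ i, Group (G i)]
    [∀ i, LinearAlgebraicGroup k (G i)] (i : ι) :
    IsRegular k (MonoidHom.mulSingle G i) :=
  regular_update G i 1

end Product

/-! ### Lie algebra, adjoint action and generalized Cayley maps -/

section Cayley

variable (k : Type u) [Field k]

/-- The Lie algebra `𝔤` of `G` as a vector space, i.e. the tangent space of `G` at `1`: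
all point derivations of `k[G]` at `1`. (The bracket plays no role here.) -/
def LieAlg (G : Type v) [Group G] [LinearAlgebraicGroup k G] :
    Submodule k (Module.Dual k (coord k G)) where
  carrier := {D | ∀ a b : coord k G, D (a * b) = a.1 1 * D b + b.1 1 * D a}
  add_mem' := by
    intro D E hD hE a b
    simp only [LinearMap.add_apply, hD a b, hE a b]
    ring
  zero_mem' := by
    intro a b
    simp
  smul_mem' := by
    intro c D hD a b
    simp only [LinearMap.smul_apply, hD a b, smul_eq_mul]
    ring

variable {k}

/-- The differential at `1` of a homomorphism of algebraic groups: `(dπ D) h = D (h ∘ π)`. -/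
def differential {G : Type v} {H : Type w} [Group G] [Group H] [LinearAlgebraicGroup k G]
    [LinearAlgebraicGroup k H] (π : G →* H) (hπ : IsRegular k π) :
    LieAlg k G →ₗ[k] LieAlg k H where
  toFun D := ⟨D.1 ∘ₗ hπ.comap.toLinearMap, by
    intro a b
    have h := D.2 (hπ.comap a) (hπ.comap b)
    simp only [LinearMap.comp_apply, AlgHom.toLinearMap_apply, map_mul]
    rw [h]
    change a.1 (π 1) * _ + b.1 (π 1) * _ = _
    rw [map_one]⟩
  map_add' _ _ := rfl
  map_smul' _ _ := rfl

/-- The adjoint action of `G` on `𝔤`: `Ad g` is the differential of `x ↦ g * x * g⁻¹`. -/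
def Ad {G : Type v} [Group G] [LinearAlgebraicGroup k G] (g : G) :
    LieAlg k G →ₗ[k] LieAlg k G :=
  differential (MulAut.conj g).toMonoidHom (regular_conj g)

/-- The embedding `k(Y) → k(X)` of function fields induced by a surjective morphism `X → Y`. -/
noncomputable def fieldComap {X : Type v} {Y : Type w} [AffineVariety k X] [AffineVariety k Y]
    [IsDomain (coord k X)] [IsDomain (coord k Y)] (f : X → Y) (hf : IsRegular k f)
    (hs : Function.Surjective f) : FunField k Y →ₐ[k] FunField k X :=
  IsFractionRing.liftAlgHom (A := coord k Y) (K := FunField k Y)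
    (g := (Algebra.algHom k (coord k X) (FunField k X)).comp hf.comap) (by
      exact (IsFractionRing.injective (coord k X) (FunField k X)).comp (hf.comap_injective hs))

variable (k)

/-- Rational maps `φ : X ⇢ V` from a variety to a finite-dimensional vector space `V`, given by
the rational functions `l ∘ φ ∈ k(X)` for the linear forms `l` on `V`
(in coordinates: by `dim V` rational functions). -/
abbrev RatMap (X : Type v) [AffineVariety k X] (V : Type w) [AddCommGroup V] [Module k V] :
    Type (max u v w) :=
  Module.Dual k V →ₗ[k] FunField k X

variable {k}

namespace RatMap

variable {X : Type v} [AffineVariety k X] {V : Type w} [AddCommGroup V] [Module k V]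

/-- The comorphism `k[V] → k(X)`, `p ↦ p ∘ φ`, where `k[V] = Sym V*` is the algebra of polynomial
functions on `V`. -/
noncomputable def comorphism (φ : RatMap k X V) :
    SymmetricAlgebra k (Module.Dual k V) →ₐ[k] FunField k X :=
  SymmetricAlgebra.lift φ

/-- `φ` is dominant: no nonzero polynomial function on `V` vanishes on the image. -/
def IsDominant (φ : RatMap k X V) : Prop := Function.Injective φ.comorphism

/-- `φ` is a birational isomorphism: its comorphism extends to an isomorphism
`k(V) ≃ k(X)` of function fields. -/
def IsBirational (φ : RatMap k X V) : Prop :=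
  ∃ e : FractionRing (SymmetricAlgebra k (Module.Dual k V)) ≃ₐ[k] FunField k X,
    ∀ p, e (algebraMap _ _ p) = φ.comorphism p

/-- `φ*(k(V))`, the subfield of `k(X)` generated by the image of `k[V]`, for dominant `φ`. -/
noncomputable def subfield [IsDomain (coord k X)] (φ : RatMap k X V) :
    IntermediateField k (FunField k X) :=
  IntermediateField.adjoin k (Set.range φ.comorphism)

/-- The degree `[k(X) : φ*(k(V))]` of a dominant rational map (`⊤` if it is infinite). -/
noncomputable def degree [IsDomain (coord k X)] (φ : RatMap k X V) : ℕ∞ :=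
  Cardinal.toENat (Module.rank φ.subfield (FunField k X))

end RatMap

section

variable {G : Type v} [Group G] [LinearAlgebraicGroup k G] [ZariskiConnected k G]

/-- Equivariance of `φ : G ⇢ 𝔤` for conjugation on `G` and the adjoint action on `𝔤`:
`φ (g x g⁻¹) = Ad g (φ x)` as rational maps in `x`, tested on linear forms on `𝔤`. -/
def IsEquivariant (φ : RatMap k G (LieAlg k G)) : Prop :=
  ∀ (g : G) (l : Module.Dual k (LieAlg k G)),
    fieldComap (k := k) (MulAut.conj g).toMonoidHom (regular_conj g)
      (MulAut.conj g).surjective (φ l) =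
      φ (l ∘ₗ Ad g)

/-- Generalized Cayley maps: dominant `G`-equivariant rational maps `G ⇢ 𝔤`. -/
def IsGeneralizedCayleyMap (φ : RatMap k G (LieAlg k G)) : Prop :=
  IsEquivariant φ ∧ φ.IsDominant

variable (k G)

/-- `G` is a Cayley group: there is an equivariant birational isomorphism `G ⇢ 𝔤`. -/
def IsCayley : Prop :=
  ∃ φ : RatMap k G (LieAlg k G), IsEquivariant φ ∧ φ.IsBirational

/-- The Cayley degree: the minimal degree of a generalized Cayley map of `G`. -/
noncomputable def cayleyDegree : ℕ∞ :=
  ⨅ φ : {φ : RatMap k G (LieAlg k G) // IsGeneralizedCayleyMap φ}, φ.1.degree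

end

variable (k) in
/-- Isogenies: surjective homomorphisms of algebraic groups with finite kernel. -/
structure IsIsogeny {G : Type v} {H : Type w} [Group G] [Group H] [LinearAlgebraicGroup k G]
    [LinearAlgebraicGroup k H] (π : G →* H) : Prop where
  regular : IsRegular k π
  surjective : Function.Surjective π
  finite_ker : Finite π.ker

/-- The product `φ₁ × ⋯ × φₙ : G₁ × ⋯ × Gₙ ⇢ Lie (G₁ × ⋯ × Gₙ) = 𝔤₁ ⊕ ⋯ ⊕ 𝔤ₙ`, that is
`x ↦ ∑ i, dιᵢ (φᵢ (xᵢ))` where `ιᵢ` is the inclusion of the `i`-th factor. -/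
noncomputable def prodMap {ι : Type w} [Fintype ι] [DecidableEq ι] {G : ι → Type v}
    [∀ i, Group (G i)] [∀ i, LinearAlgebraicGroup k (G i)] [∀ i, ZariskiConnected k (G i)]
    (φ : ∀ i, RatMap k (G i) (LieAlg k (G i))) :
    RatMap k (∀ i, G i) (LieAlg k (∀ i, G i)) :=
  ∑ i, (fieldComap (fun x : ∀ i, G i => x i) (regular_proj G i)
      (Function.surjective_eval i)).toLinearMap ∘ₗ φ i ∘ₗ
    (differential (MonoidHom.mulSingle G i) (regular_single G i)).dualMap

end Cayley

end CayleyDeg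

/-! For (a), a generalized Cayley map `φ` of `H` is pulled back to `(dπ)⁻¹ ∘ φ ∘ π` on `G`. This
requires `dπ` to be bijective and multiplies the degree by `[k(G) : π* k(H)]`; only the bound of
this factor by the order of the kernel is needed. That bound is Artin's, once every rational
function on `G` fixed by right translation by `ker π` is known to come from `H`
(`fracComap_mul_right_fixed_mem_range`). Such a function takes equal values at points with the same
image under `π`; by the Nullstellensatz `θ ⊗ 1 - 1 ⊗ θ` is then nilpotent in `k(G) ⊗ k(G)` over
`k(H)`, which in characteristic zero forces `θ` into `k(H)`.

Bijectivity of `dπ` (`differential_bijective`) uses left-invariant derivations. As `k(G)` is finite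
and separable over `k(H)`, each derivation of `k[H]` has exactly one extension to `k(G)`. Uniqueness
gives injectivity. It also makes the extension of a left-invariant derivation commute with
translations, so that it preserves `k[G]` and can be evaluated at `1`; this gives surjectivity.

For (a₂), a generalized Cayley map of degree one is birational, so a non-Cayley group has Cayley
degree at least `2`, while the bound in (a₁) is at most `2`.

For (b), the subfields `k(Gᵢ)` of `k(G₁ × ⋯ × Gₙ)` are linearly disjoint over `k` and generate it
(`linearDisjoint_fieldRange_proj`, `finset_univ_sup_fieldRange_proj`). Linear disjointness keeps the
union of algebraically independent families independent, which is dominance, and makes degrees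
multiply along a tower (`toENat_relrank_finset_sup`). -/

namespace CayleyDeg

/-! ### Descent of invariant rational functions and Artin's bound -/

section Descent

open TensorProduct Polynomial

/-- Flatness over the field `K` embeds `S ⊗ S` into `L ⊗ L`, so the difference is already nilpotent
there; the homomorphism `σ ⊗ τ` into the reduced ring `Ω` must kill it. -/
theorem eq_of_isNilpotent_tmul_sub {K L S Ω : Type*} [Field K] [Field L] [Algebra K L]
    [CommRing S] [Algebra K S] [CommRing Ω] [IsReduced Ω] [Algebra K Ω] (i : S →ₐ[K] L)
    (hi : Function.Injective i) (s : S)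
    (h : IsNilpotent (i s ⊗ₜ[K] (1 : L) - (1 : L) ⊗ₜ[K] i s)) (σ τ : S →ₐ[K] Ω) : σ s = τ s := by
  have hinj : Function.Injective (Algebra.TensorProduct.map i i) :=
    TensorProduct.map_injective_of_flat_flat i.toLinearMap i.toLinearMap hi hi
  have h' : IsNilpotent (s ⊗ₜ[K] (1 : S) - (1 : S) ⊗ₜ[K] s) := by
    rw [← IsNilpotent.map_iff hinj]
    simpa using h
  have h'' := (h'.map (Algebra.TensorProduct.lift σ τ fun _ _ => Commute.all _ _)).eq_zero
  simpa [sub_eq_zero] using h''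

/-- In characteristic zero, an element `θ` of a field extension `L / K` such that
`θ ⊗ 1 - 1 ⊗ θ` is nilpotent in `L ⊗ L` lies in `K`. -/
theorem mem_range_of_isNilpotent_tmul_sub {K L : Type*} [Field K] [CharZero K] [Field L]
    [Algebra K L] (θ : L) (h : IsNilpotent (θ ⊗ₜ[K] (1 : L) - (1 : L) ⊗ₜ[K] θ)) :
    θ ∈ (algebraMap K L).range := by
  by_cases hθ : IsIntegral K θ
  · rw [← minpoly.natDegree_eq_one_iff]
    have hsep : IsSeparable K θ := (minpoly.irreducible hθ).separable
    have hcard := IntermediateField.card_algHom_adjoin_integral K (K := AlgebraicClosure K) hθ hsep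
      (IsAlgClosed.splits _)
    -- All embeddings of `K(θ)` into an algebraic closure agree on `θ`; by separability their number
    -- is the degree of `θ`, which is therefore one.
    have hsub : Subsingleton (IntermediateField.adjoin K {θ} →ₐ[K] AlgebraicClosure K) := by
      refine ⟨fun σ τ => IntermediateField.algHom_ext_of_eq_adjoin _ rfl ?_⟩
      rintro x rfl
      exact eq_of_isNilpotent_tmul_sub (IntermediateField.adjoin K {x}).val
        Subtype.val_injective (IntermediateField.AdjoinSimple.gen K x) h σ τ
    have := minpoly.natDegree_pos hθ
    have hle : (minpoly K θ).natDegree ≤ 1 := by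
      rw [← hcard]
      exact Finite.card_le_one_iff_subsingleton.2 hsub
    omega
  · have ht : Transcendental K θ := fun h' => hθ h'.isIntegral
    -- Here `K[X]` embeds in `L`, and the identity and the shift `X ↦ X + 1` would have to agree on
    -- `X`.
    have := eq_of_isNilpotent_tmul_sub (aeval θ) (transcendental_iff_injective.1 ht) X
      (by simpa using h) (AlgHom.id K K[X]) (aeval (X + 1))
    simp at this

/-- Nullstellensatz: a maximal ideal of a finitely generated algebra over an algebraically closed
field is contained in the kernel of a point. -/
theorem exists_algHom_of_isMaximal {k R : Type*} [Field k] [IsAlgClosed k] [CommRing R]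
    [Algebra k R] [Algebra.FiniteType k R] (m : Ideal R) [hm : m.IsMaximal] :
    ∃ χ : R →ₐ[k] k, ∀ x ∈ m, χ x = 0 := by
  let _ := Ideal.Quotient.field m
  have : Algebra.FiniteType k (R ⧸ m) := .trans ‹Algebra.FiniteType k R› inferInstance
  have : Module.Finite k (R ⧸ m) := finite_of_finite_type_of_isJacobsonRing k (R ⧸ m)
  let e := AlgEquiv.ofBijective (Algebra.ofId k (R ⧸ m))
    (IsAlgClosed.algebraMap_bijective_of_isIntegral (k := k) (K := R ⧸ m))
  refine ⟨e.symm.toAlgHom.comp (Ideal.Quotient.mkₐ k m), fun x hx => ?_⟩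
  have : Ideal.Quotient.mk m x = 0 := Ideal.Quotient.eq_zero_iff_mem.2 hx
  simp [this]

/-- In a Jacobson ring the nilradical is the Jacobson radical. If `x` were outside it, some `1 + x *
y` would be a nonunit, and the point given by a maximal ideal containing it would send it both to
`0` and to `1`. -/
theorem isNilpotent_of_forall_algHom_eq_zero {k R : Type*} [Field k] [IsAlgClosed k] [CommRing R]
    [Algebra k R] [Algebra.FiniteType k R] (x : R) (h : ∀ χ : R →ₐ[k] k, χ x = 0) :
    IsNilpotent x := by
  have : IsJacobsonRing R := isJacobsonRing_of_finiteType (A := k)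
  rw [← mem_nilradical, nilradical, Ideal.radical_eq_jacobson, Ideal.mem_jacobson_iff]
  intro y
  by_contra! hy
  have hunit : ¬ IsUnit (1 + x * y) := by
    rintro ⟨u, hu⟩
    refine hy (u⁻¹ : Rˣ) ?_
    have : ((u⁻¹ : Rˣ) : R) * (1 + x * y) = 1 := by rw [← hu]; simp
    refine Ideal.mem_bot.2 ?_
    linear_combination this
  obtain ⟨m, hm, hxm⟩ := exists_max_ideal_of_mem_nonunits hunit
  obtain ⟨χ, hχ⟩ := exists_algHom_of_isMaximal (k := k) m
  have := hχ _ hxm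
  simp [h χ] at this

/-- Let `A → B` be a homomorphism of finitely generated domains over an algebraically closed field
of characteristic zero. An element of `Frac B` whose values at two points of `Spec B` agree
whenever these points lie over the same point of `Spec A` comes from a field containing `A`. -/
theorem mem_range_of_forall_algHom {k A B K L : Type*} [Field k] [IsAlgClosed k]
    [CommRing A] [CommRing B] [Field K] [CharZero K] [Field L] [Algebra k A] [Algebra k B]
    [Algebra A B] [IsScalarTower k A B] [Algebra A K] [Algebra A L] [Algebra K L] [Algebra B L]
    [IsScalarTower A K L] [IsScalarTower A B L] [Algebra.FiniteType k B] (b c : B)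
    (hc : algebraMap B L c ≠ 0)
    (h : ∀ χ₁ χ₂ : B →ₐ[k] k, (∀ a : A, χ₁ (algebraMap A B a) = χ₂ (algebraMap A B a)) →
      χ₁ b * χ₂ c = χ₁ c * χ₂ b) :
    algebraMap B L b / algebraMap B L c ∈ (algebraMap K L).range := by
  have hft : Algebra.FiniteType k (B ⊗[A] B) :=
    have : Algebra.FiniteType B (B ⊗[A] B) := by
      have : Algebra.FiniteType A B := .of_restrictScalars_finiteType k A B
      infer_instance
    .trans ‹Algebra.FiniteType k B› this
  -- A point of `B ⊗[A] B` is a pair of points of `B` over the same point of `A`, so the hypothesis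
  -- says that this element vanishes at every point.
  have hnil : IsNilpotent (b ⊗ₜ[A] c - c ⊗ₜ[A] b) := by
    refine isNilpotent_of_forall_algHom_eq_zero (k := k) _ fun χ => ?_
    let χ₁ : B →ₐ[k] k := χ.comp (Algebra.TensorProduct.includeLeft (R := A) (S := k) (B := B))
    let χ₂ : B →ₐ[k] k := χ.comp
      ((Algebra.TensorProduct.includeRight (R := A) (A := B) (B := B)).restrictScalars k)
    have key : ∀ x y : B, χ (x ⊗ₜ y) = χ₁ x * χ₂ y := fun x y => by
      change _ = χ (x ⊗ₜ 1) * χ (1 ⊗ₜ y)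
      rw [← map_mul, Algebra.TensorProduct.tmul_mul_tmul, mul_one, one_mul]
    rw [map_sub, key, key, sub_eq_zero]
    refine h χ₁ χ₂ fun a => ?_
    change χ (algebraMap A B a ⊗ₜ 1) = χ (1 ⊗ₜ algebraMap A B a)
    rw [Algebra.algebraMap_eq_smul_one, TensorProduct.smul_tmul]
  let f : B ⊗[A] B →ₐ[A] L ⊗[K] L := Algebra.TensorProduct.lift
    ((Algebra.TensorProduct.includeLeft (R := K) (S := A) (A := L) (B := L)).comp
      (IsScalarTower.toAlgHom A B L))
    (((Algebra.TensorProduct.includeRight (R := K) (A := L) (B := L)).restrictScalars A).comp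
      (IsScalarTower.toAlgHom A B L)) fun _ _ => Commute.all _ _
  have hf : ∀ x y, f (x ⊗ₜ y) = algebraMap B L x ⊗ₜ algebraMap B L y := fun x y => by
    simp [f]
  refine mem_range_of_isNilpotent_tmul_sub _ ?_
  have h1 := hnil.map f
  rw [map_sub, hf, hf] at h1
  -- Multiplying by `c⁻¹ ⊗ c⁻¹` turns `b ⊗ c - c ⊗ b` into `θ ⊗ 1 - 1 ⊗ θ` for `θ = b / c`.
  have h2 := (Commute.all ((algebraMap B L c)⁻¹ ⊗ₜ[K] (algebraMap B L c)⁻¹) _).isNilpotent_mul_left h1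
  rw [mul_sub, Algebra.TensorProduct.tmul_mul_tmul, Algebra.TensorProduct.tmul_mul_tmul,
    inv_mul_cancel₀ hc, inv_mul_eq_div] at h2
  exact h2

theorem div_mem_fieldRange_of_forall_algHom {k A B K L : Type*} [Field k] [IsAlgClosed k]
    [CharZero k] [CommRing A] [CommRing B] [Field K] [Field L] [Algebra k A] [Algebra k B]
    [Algebra k K] [Algebra k L] [Algebra A K] [Algebra B L] [Algebra.FiniteType k B]
    (p : A →ₐ[k] B) (q : K →ₐ[k] L) (hpq : ∀ a, q (algebraMap A K a) = algebraMap B L (p a))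
    (b c : B) (hc : algebraMap B L c ≠ 0)
    (h : ∀ χ₁ χ₂ : B →ₐ[k] k, (∀ a : A, χ₁ (p a) = χ₂ (p a)) → χ₁ b * χ₂ c = χ₁ c * χ₂ b) :
    algebraMap B L b / algebraMap B L c ∈ q.fieldRange := by
  let _ : Algebra A B := p.toRingHom.toAlgebra
  let _ : Algebra K L := q.toRingHom.toAlgebra
  let _ : Algebra A L := ((algebraMap B L).comp p.toRingHom).toAlgebra
  have : IsScalarTower A B L := .of_algebraMap_eq fun _ => rfl
  have : IsScalarTower A K L := .of_algebraMap_eq fun a => (hpq a).symm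
  have : IsScalarTower k A B := .of_algebraMap_eq fun a => (p.commutes a).symm
  have : CharZero K := charZero_of_injective_algebraMap (algebraMap k K).injective
  exact mem_range_of_forall_algHom (k := k) (A := A) (K := K) b c hc h

/-- Artin's bound `[L : K] ≤ |M|` when `K` contains the invariants of a finite group `M`. -/
theorem rank_le_card_of_forall_fixed {k M L : Type*} [Field k] [Group M] [Finite M] [Field L]
    [Algebra k L] (ρ : M → (L →ₐ[k] L)) (h1 : ∀ x, ρ 1 x = x)
    (hmul : ∀ m m' x, ρ (m * m') x = ρ m (ρ m' x))
    (K : IntermediateField k L) (h : ∀ x, (∀ m, ρ m x = x) → x ∈ K) :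
    Module.rank K L ≤ Nat.card M := by
  let _ := Fintype.ofFinite M
  let ρ' : M →* (L →+* L) :=
    { toFun := fun m => (ρ m).toRingHom
      map_one' := RingHom.ext h1
      map_mul' := fun m m' => RingHom.ext (hmul m m') }
  let _ : MulSemiringAction M L := MulSemiringAction.compHom L ρ'
  have hle : FixedPoints.subfield M L ≤ K.toSubfield := fun x hx => h x hx
  -- In the tower from the fixed field through `K` to `L`, the degree of `L` over `K` is at most
  -- that over the fixed field.
  have h1 := Subfield.relrank_mul_rank_top hle
  rw [Nat.card_eq_fintype_card]
  refine le_trans ?_ (FixedPoints.rank_le_card M L)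
  rw [← h1]
  refine le_mul_of_one_le_left' ?_
  rw [Cardinal.one_le_iff_pos, Subfield.relrank_eq_rank_of_le hle]
  exact rank_pos

end Descent

/-! ### Unique extension of derivations in characteristic zero -/

section Derivation

open TensorProduct Polynomial

variable {k A L : Type*} [CommRing k] [CommRing A] [Field L] [Algebra k A] [Algebra k L]
  [Algebra A L] [IsScalarTower k A L]

/-- Localization is formally étale, and so is an algebraic extension in characteristic zero, being
separable. -/
theorem formallyEtale_of_isAlgebraic {A K L : Type*} [CommRing A] [IsDomain A] [Field K] [CharZero K] [Field L]
    [Algebra A K] [IsFractionRing A K] [Algebra K L] [Algebra A L] [IsScalarTower A K L]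
    [Algebra.IsAlgebraic K L] : Algebra.FormallyEtale A L := by
  have : Algebra.FormallyEtale A K := .of_isLocalization (nonZeroDivisors A)
  have : Algebra.FormallyEtale K L := .of_isSeparable _ _
  exact .comp A K L

/-- Formal étaleness makes the differentials of `L` the base change of those of `A`. Uniqueness of
extensions is read off here, existence in `exists_derivation_of_formallyEtale`. -/
theorem derivation_ext_of_formallyEtale [Algebra.FormallyEtale A L] {D₁ D₂ : Derivation k L L}
    (h : ∀ a : A, D₁ (algebraMap A L a) = D₂ (algebraMap A L a)) : D₁ = D₂ := by
  have hb := KaehlerDifferential.isBaseChange_of_formallyEtale k A L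
  have key : D₁.liftKaehlerDifferential = D₂.liftKaehlerDifferential := by
    refine hb.algHom_ext _ _ fun ω => ?_
    have hω : ω ∈ Submodule.span A (Set.range (KaehlerDifferential.D k A)) := by
      rw [KaehlerDifferential.span_range_derivation]
      trivial
    induction hω using Submodule.span_induction with
    | mem ω hω =>
      obtain ⟨a, rfl⟩ := hω
      simpa using h a
    | zero => simp
    | add x y _ _ hx hy => rw [map_add, map_add, map_add, hx, hy]
    | smul a x _ hx =>
      rw [map_smul, LinearMap.map_smul_of_tower, LinearMap.map_smul_of_tower, hx]
  ext x
  simpa using LinearMap.congr_fun key (KaehlerDifferential.D k L x)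

theorem exists_derivation_of_formallyEtale [Algebra.FormallyEtale A L] (D : Derivation k A L) :
    ∃ D' : Derivation k L L, ∀ a : A, D' (algebraMap A L a) = D a := by
  have hb := KaehlerDifferential.isBaseChange_of_formallyEtale k A L
  refine ⟨(hb.lift D.liftKaehlerDifferential).compDer (KaehlerDifferential.D k L), fun a => ?_⟩
  have := hb.lift_eq D.liftKaehlerDifferential (KaehlerDifferential.D k A a)
  simpa using this

theorem formallyEtale_of_rank_fieldRange_lt {k A K L : Type*} [Field k] [CharZero k]
    [CommRing A] [IsDomain A] [Field K] [Field L] [Algebra k K] [Algebra k L]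
    [Algebra A K] [IsFractionRing A K] [Algebra A L] (q : K →ₐ[k] L)
    (hq : ∀ a, q (algebraMap A K a) = algebraMap A L a)
    (hrank : Module.rank q.fieldRange L < Cardinal.aleph0) : Algebra.FormallyEtale A L := by
  let _ : Algebra K L := q.toRingHom.toAlgebra
  have : IsScalarTower A K L := .of_algebraMap_eq fun a => (hq a).symm
  have : CharZero K := charZero_of_injective_algebraMap (algebraMap k K).injective
  have : FiniteDimensional q.fieldRange L := Module.rank_lt_aleph0_iff.1 hrank
  have : Algebra.IsAlgebraic K L := .of_ringHom_of_comp_eq (S := q.fieldRange) (B := L)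
    q.rangeRestrict.toRingHom (RingHom.id L) q.rangeRestrict_surjective Function.injective_id rfl
  exact formallyEtale_of_isAlgebraic (K := K)

theorem derivation_ext_of_rank_fieldRange_lt {k A K L : Type*} [Field k] [CharZero k]
    [CommRing A] [IsDomain A] [Field K] [Field L] [Algebra k A] [Algebra k K] [Algebra k L]
    [Algebra A K] [IsFractionRing A K] (r : A →ₐ[k] L) (q : K →ₐ[k] L)
    (hq : ∀ a, q (algebraMap A K a) = r a)
    (hrank : Module.rank q.fieldRange L < Cardinal.aleph0) {D₁ D₂ : Derivation k L L}
    (h : ∀ a, D₁ (r a) = D₂ (r a)) : D₁ = D₂ := by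
  let _ : Algebra A L := r.toRingHom.toAlgebra
  have : IsScalarTower k A L := .of_algebraMap_eq fun a => (r.commutes a).symm
  have := formallyEtale_of_rank_fieldRange_lt q hq hrank
  exact derivation_ext_of_formallyEtale (A := A) h

theorem exists_derivation_of_rank_fieldRange_lt {k A K L : Type*} [Field k] [CharZero k]
    [CommRing A] [IsDomain A] [Field K] [Field L] [Algebra k A] [Algebra k K] [Algebra k L]
    [Algebra A K] [IsFractionRing A K] (r : A →ₐ[k] L) (q : K →ₐ[k] L)
    (hq : ∀ a, q (algebraMap A K a) = r a)
    (hrank : Module.rank q.fieldRange L < Cardinal.aleph0) (D : Derivation k A A) :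
    ∃ D' : Derivation k L L, ∀ a, D' (r a) = r (D a) := by
  let _ : Algebra A L := r.toRingHom.toAlgebra
  have : IsScalarTower k A L := .of_algebraMap_eq fun a => (r.commutes a).symm
  have := formallyEtale_of_rank_fieldRange_lt q hq hrank
  exact exists_derivation_of_formallyEtale ((Algebra.linearMap A L).compDer D)

theorem exists_derivation_fractionRing {k B L : Type*} [Field k] [CommRing B] [IsDomain B]
    [Field L] [Algebra k B] [Algebra k L] [Algebra B L] [IsScalarTower k B L] [IsFractionRing B L]
    (D : Derivation k B B) :
    ∃ D' : Derivation k L L, ∀ b, D' (algebraMap B L b) = algebraMap B L (D b) := by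
  have : Algebra.FormallyEtale B L := .of_isLocalization (nonZeroDivisors B)
  exact exists_derivation_of_formallyEtale ((Algebra.linearMap B L).compDer D)

/-- The values of a derivation of `Frac B` on a finitely generated algebra `B` have a common
denominator. -/
theorem exists_denominator_derivation {k B L : Type*} [Field k] [CommRing B] [IsDomain B]
    [Field L] [Algebra k B] [Algebra k L] [Algebra B L] [IsScalarTower k B L] [IsFractionRing B L]
    [hB : Algebra.FiniteType k B] (D : Derivation k L L) :
    ∃ c : B, c ≠ 0 ∧ ∀ b, algebraMap B L c * D (algebraMap B L b) ∈ (algebraMap B L).range := by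
  obtain ⟨s, hs⟩ := hB.out
  classical
  obtain ⟨c, hc⟩ := IsLocalization.exist_integer_multiples_of_finset (nonZeroDivisors B)
    (s.image fun b => D (algebraMap B L b))
  refine ⟨c, nonZeroDivisors.ne_zero c.2, fun b => ?_⟩
  have hb : b ∈ Algebra.adjoin k (s : Set B) := by
    rw [hs]
    trivial
  -- The element `c` clears denominators on the generators; the Leibniz rule shows that products
  -- need no larger denominator.
  induction hb using Algebra.adjoin_induction with
  | mem b hb =>
    have := hc _ (Finset.mem_image_of_mem _ hb)
    rwa [Algebra.smul_def] at this
  | algebraMap r =>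
    rw [← IsScalarTower.algebraMap_apply, D.map_algebraMap, mul_zero]
    exact zero_mem _
  | add x y _ _ hx hy =>
    rw [map_add, map_add, mul_add]
    exact add_mem hx hy
  | mul x y _ _ hx hy =>
    rw [map_mul, D.leibniz, mul_add, smul_eq_mul, smul_eq_mul, mul_left_comm,
      mul_left_comm (algebraMap B L c)]
    exact add_mem (mul_mem ⟨x, rfl⟩ hy) (mul_mem ⟨y, rfl⟩ hx)

theorem exists_derivation_of_forall_mem_range {k B L : Type*} [Field k] [CommRing B]
    [Field L] [Algebra k B] [Algebra k L] [Algebra B L] [IsScalarTower k B L]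
    (hinj : Function.Injective (algebraMap B L)) (D : Derivation k L L)
    (h : ∀ b, D (algebraMap B L b) ∈ (algebraMap B L).range) :
    ∃ d : Derivation k B B, ∀ b, algebraMap B L (d b) = D (algebraMap B L b) := by
  choose d hd using h
  refine ⟨Derivation.mk'
    { toFun := d
      map_add' := fun x y => hinj (by simp [hd])
      map_smul' := fun r x => hinj (by
        have hs : ∀ y, algebraMap B L (r • y) = r • algebraMap B L y :=
          fun y => map_smul (IsScalarTower.toAlgHom k B L) r y
        rw [hd, RingHom.id_apply, hs, hs, D.map_smul, hd]) }
    fun x y => hinj (by simp [hd]), hd⟩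

/-- The conjugate `τ ∘ D ∘ σ` of a derivation by an automorphism `σ` with inverse `τ`. -/
def conjDerivation {k L : Type*} [Field k] [Field L] [Algebra k L] (D : Derivation k L L)
    (σ τ : L →ₐ[k] L) (h : ∀ x, τ (σ x) = x) : Derivation k L L :=
  Derivation.mk' (τ.toLinearMap ∘ₗ D.toLinearMap ∘ₗ σ.toLinearMap) fun x y => by
    simp [h]

end Derivation

/-! ### Linear disjointness and degrees of composita -/

section LinearDisjoint

open IntermediateField Cardinal
open scoped IntermediateField.algebraAdjoinAdjoin

variable {k E : Type*} [Field k] [Field E] [Algebra k E]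

/-- A `k`-basis of `X` stays independent over the algebra generated by `S`, hence over its field of
fractions. -/
theorem linearDisjoint_adjoin_right {X : Subalgebra k E} {S : Set E}
    (H : X.LinearDisjoint (Algebra.adjoin k S)) :
    X.LinearDisjoint (adjoin k S).toSubalgebra := by
  let a := Module.Free.chooseBasis k X
  refine Subalgebra.LinearDisjoint.of_basis_left _ _ a ?_
  have h1 := H.linearIndependent_left_of_flat a.linearIndependent
  exact (LinearIndependent.iff_fractionRing (Algebra.adjoin k S) (adjoin k S)).1 h1

/-- Linear disjointness passes from subalgebras to their fields of fractions. -/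
theorem linearDisjoint_adjoin {S T : Set E}
    (H : (Algebra.adjoin k S).LinearDisjoint (Algebra.adjoin k T)) :
    (adjoin k S).LinearDisjoint (adjoin k T) := by
  rw [linearDisjoint_iff']
  exact (linearDisjoint_adjoin_right (linearDisjoint_adjoin_right H).symm).symm

/-- If `A` and `B` are linearly disjoint over `k` and `F ⊆ A`, then `A` and `F(B)` are linearly
disjoint over `F`. -/
theorem linearDisjoint_extendScalars {A B F : IntermediateField k E} (H : A.LinearDisjoint B)
    (hF : F ≤ A) :
    (IntermediateField.extendScalars hF).LinearDisjoint (adjoin F (B : Set E)) := by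
  rw [linearDisjoint_iff']
  refine linearDisjoint_adjoin_right ?_
  let b := Module.Free.chooseBasis k B
  have hbF : LinearIndependent F (B.val ∘ b) :=
    (H.of_le_left hF).linearIndependent_right b.linearIndependent
  have hbA : LinearIndependent A (B.val ∘ b) := H.linearIndependent_right b.linearIndependent
  -- Since `B` is closed under multiplication, a `k`-basis of `B` already spans `F[B]` over `F`; it
  -- is an `F`-basis that remains independent over `A`.
  have hspan : Subalgebra.toSubmodule (Algebra.adjoin F (B : Set E)) =
      Submodule.span F (Set.range (B.val ∘ b)) := by
    rw [Algebra.adjoin_eq_span]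
    have hcl : (Submonoid.closure (B : Set E) : Set E) = B :=
      congrArg SetLike.coe (Submonoid.closure_eq B.toSubmonoid)
    rw [hcl]
    apply le_antisymm
    · refine Submodule.span_le.2 fun x hx => ?_
      have h1 : (⟨x, hx⟩ : B) ∈ Submodule.span k (Set.range b) := by
        rw [b.span_eq]
        trivial
      have h2 := Submodule.mem_map_of_mem (f := B.val.toLinearMap) h1
      rw [Submodule.map_span, ← Set.range_comp] at h2
      exact Submodule.span_subset_span k F _ h2
    · refine Submodule.span_mono ?_
      rintro _ ⟨i, rfl⟩
      exact (b i).2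
  let e : Submodule.span F (Set.range (B.val ∘ b)) ≃ₗ[F] Algebra.adjoin F (B : Set E) :=
    LinearEquiv.ofEq _ _ hspan.symm
  refine Subalgebra.LinearDisjoint.of_basis_right _ _ ((Module.Basis.span hbF).map e) ?_
  have : ((Algebra.adjoin F (B : Set E)).val ∘ (Module.Basis.span hbF).map e) = B.val ∘ b := by
    funext i
    change ((Module.Basis.span hbF i : Submodule.span F (Set.range (B.val ∘ b))) : E) = _
    rw [Module.Basis.span_apply]
  rw [this]
  exact hbA

/-- The degree is preserved by linearly disjoint base change (including infinite degrees). -/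
theorem toENat_rank_adjoin_of_linearDisjoint {A L : IntermediateField k E} (H : A.LinearDisjoint L) :
    toENat (Module.rank L (adjoin L (A : Set E))) = toENat (Module.rank k A) := by
  by_cases hfin : Module.rank k A < ℵ₀
  · have : FiniteDimensional k A := Module.rank_lt_aleph0_iff.1 hfin
    rw [H.adjoin_rank_eq_rank_left_of_isAlgebraic_left]
  -- In infinite degree a basis of `A` stays independent over `L`, so both ranks are infinite, and
  -- `toENat` does not distinguish infinite cardinals.
  · let a := Module.Free.chooseBasis k A
    have h1 : LinearIndependent L (A.val ∘ a) := H.linearIndependent_left a.linearIndependent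
    let a' : _ → adjoin L (A : Set E) := fun i => ⟨a i, subset_adjoin _ _ (a i).2⟩
    have h2 : LinearIndependent L a' := .of_comp (adjoin L (A : Set E)).val.toLinearMap h1
    have h3 := h2.cardinal_le_rank
    rw [a.mk_eq_rank''] at h3
    rw [not_lt] at hfin
    rw [toENat_eq_top.2 hfin, toENat_eq_top.2 (hfin.trans h3)]

/-- The extension is `F(B)(A)` over `F(B)`. As `A` and `F(B)` are linearly disjoint over `F`, it is
a base change of `A` over `F`. -/
theorem toENat_relrank_sup_of_linearDisjoint {A B F : IntermediateField k E} (H : A.LinearDisjoint B)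
    (hF : F ≤ A) : toENat (relrank (F ⊔ B) (A ⊔ B)) = toENat (relrank F A) := by
  have h1 : (adjoin F (B : Set E)).restrictScalars k = F ⊔ B := by
    rw [restrictScalars_adjoin, adjoin_union, adjoin_self, adjoin_self]
  let L := adjoin F (B : Set E)
  let M := (adjoin L (A : Set E)).restrictScalars F
  have h2 : M.restrictScalars k = A ⊔ B := by
    have : M = adjoin F ((L : Set E) ∪ A) := restrictScalars_adjoin F L A
    rw [this, restrictScalars_adjoin, adjoin_union, adjoin_union, adjoin_self, adjoin_self]
    have h3 : adjoin k (L : Set E) = F ⊔ B := by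
      rw [← h1]
      exact adjoin_self k (L.restrictScalars k)
    rw [h3, ← sup_assoc, ← sup_assoc, sup_idem, sup_right_comm, sup_eq_right.2 hF]
  have hLM : L ≤ M := fun x hx => IntermediateField.algebraMap_mem (adjoin L (A : Set E)) (⟨x, hx⟩ : L)
  have h4 : relrank (F ⊔ B) (A ⊔ B) = relrank L M := by
    rw [← h1, ← h2]
    rfl
  rw [h4, relrank_eq_rank_of_le hF, relrank_eq_rank_of_le hLM,
    ← toENat_rank_adjoin_of_linearDisjoint (linearDisjoint_extendScalars H hF)]
  rfl

/-- Base change is applied to both steps of the tower `F ⊔ F' ≤ A ⊔ F' ≤ A ⊔ B`. -/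
theorem toENat_relrank_sup_sup {A B F F' : IntermediateField k E} (H : A.LinearDisjoint B)
    (hF : F ≤ A) (hF' : F' ≤ B) :
    toENat (relrank (F ⊔ F') (A ⊔ B)) = toENat (relrank F A) * toENat (relrank F' B) := by
  rw [← relrank_mul_relrank (sup_le_sup_right hF F') (sup_le_sup_left hF' A), map_mul,
    toENat_relrank_sup_of_linearDisjoint (H.of_le_right hF') hF, sup_comm A F', sup_comm A B,
    toENat_relrank_sup_of_linearDisjoint H.symm hF']

theorem toENat_relrank_finset_sup {ι : Type*} [DecidableEq ι] {A F : ι → IntermediateField k E}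
    (hF : ∀ i, F i ≤ A i) (H : ∀ (s : Finset ι) (j : ι), j ∉ s → (s.sup A).LinearDisjoint (A j))
    (s : Finset ι) :
    toENat (relrank (s.sup F) (s.sup A)) = ∏ i ∈ s, toENat (relrank (F i) (A i)) := by
  induction s using Finset.induction_on with
  | empty => simp
  | insert j s hj ih =>
    rw [Finset.sup_insert, Finset.sup_insert, Finset.prod_insert hj, ← ih,
      toENat_relrank_sup_sup (H s j hj).symm (hF j) (Finset.sup_mono_fun fun i _ => hF i)]

end LinearDisjoint

/-! ### Algebraic independence across linearly disjoint fields -/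

section AlgebraicIndependent

open IntermediateField MvPolynomial

theorem algebraicIndependent_iff_linearIndependent_monomial {R A κ : Type*} [CommRing R]
    [CommRing A] [Algebra R A] {y : κ → A} :
    AlgebraicIndependent R y ↔ LinearIndependent R (fun s : κ →₀ ℕ => aeval (R := R) y (monomial s 1)) := by
  have : Finsupp.linearCombination R (fun s : κ →₀ ℕ => aeval (R := R) y (monomial s 1)) =
      (aeval (R := R) y).toLinearMap ∘ₗ (basisMonomials κ R).repr.symm.toLinearMap := by
    ext s
    simp [coe_basisMonomials]
  rw [LinearIndependent, this, LinearMap.coe_comp]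
  exact (EquivLike.injective_comp (basisMonomials κ R).repr.symm _).symm

variable {k E : Type*} [Field k] [Field E] [Algebra k E]

/-- The monomials in `y` lie in `B` and are linearly independent over `k`, hence over `A`. -/
theorem algebraicIndependent_of_linearDisjoint {A B : IntermediateField k E} {κ : Type*}
    {y : κ → E} (hy : AlgebraicIndependent k y) (hyB : ∀ i, y i ∈ B) (H : A.LinearDisjoint B) :
    AlgebraicIndependent A y := by
  rw [algebraicIndependent_iff_linearIndependent_monomial] at hy ⊢
  have hmem : ∀ s : κ →₀ ℕ, aeval (R := k) y (monomial s 1) ∈ B := fun s => by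
    rw [aeval_monomial, map_one, one_mul]
    exact prod_mem fun i _ => pow_mem (hyB i) _
  have h1 : LinearIndependent k (fun s : κ →₀ ℕ => (⟨_, hmem s⟩ : B)) :=
    .of_comp B.val.toLinearMap hy
  have h2 := H.linearIndependent_right h1
  have h3 : (fun s : κ →₀ ℕ => aeval (R := A) y (monomial s 1)) =
      B.val ∘ fun s => (⟨_, hmem s⟩ : B) := by
    funext s
    simp [aeval_monomial]
  rw [h3]
  exact h2

/-- Factors are added one at a time: the new family is independent over the compositum of the fields
containing the earlier ones. -/
theorem algebraicIndependent_sigma_of_linearDisjoint {ι : Type*} [DecidableEq ι] {κ : ι → Type*}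
    {A : ι → IntermediateField k E} (f : ∀ i, κ i → E) (hA : ∀ i b, f i b ∈ A i)
    (hf : ∀ i, AlgebraicIndependent k (f i))
    (H : ∀ (s : Finset ι) (j : ι), j ∉ s → (s.sup A).LinearDisjoint (A j)) (s : Finset ι) :
    AlgebraicIndependent k (fun x : {x : Σ i, κ i // x.1 ∈ s} => f x.1.1 x.1.2) := by
  induction s using Finset.induction_on with
  | empty =>
    have : IsEmpty {x : Σ i, κ i // x.1 ∈ (∅ : Finset ι)} := ⟨fun x => by simpa using x.2⟩
    rw [algebraicIndependent_empty_type_iff]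
    exact (algebraMap k E).injective
  | insert j s hj ih =>
    have h1 := algebraicIndependent_of_linearDisjoint (hf j) (hA j) (H s j hj)
    have h2 := ih.sumElim_of_tower (S := ↥(s.sup A)) ?_ h1
    · let e : {x : Σ i, κ i // x.1 ∈ insert j s} → κ j ⊕ {x : Σ i, κ i // x.1 ∈ s} := fun x =>
        if h : x.1.1 = j then .inl (h ▸ x.1.2)
        else .inr ⟨x.1, Finset.mem_of_mem_insert_of_ne x.2 h⟩
      have he : ∀ x, Sum.elim (f j) (fun x : {x : Σ i, κ i // x.1 ∈ s} => f x.1.1 x.1.2) (e x) =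
          f x.1.1 x.1.2 := by
        rintro ⟨⟨i, b⟩, hx⟩
        by_cases h : i = j
        · subst h
          simp [e]
        · simp [e, h]
      have hinj : Function.Injective e := by
        rintro ⟨⟨i, b⟩, hx⟩ ⟨⟨i', b'⟩, hx'⟩ hxx
        by_cases h : i = j <;> by_cases h' : i' = j
        · subst h
          subst h'
          simp_all [e]
        · simp [e, h, h'] at hxx
        · simp [e, h, h'] at hxx
        · simpa [e, h, h'] using hxx
      have h3 := h2.comp e hinj
      convert h3 using 1
      funext x
      exact (he x).symm
    · rintro _ ⟨⟨⟨i, b⟩, hi⟩, rfl⟩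
      exact ⟨⟨f i b, (Finset.le_sup (f := A) hi) (hA i b)⟩, rfl⟩

end AlgebraicIndependent

/-! ### Functoriality of function fields -/

section FracComap

variable {k : Type*} [Field k] {X Y Z : Type*} [AffineVariety k X] [AffineVariety k Y]
  [AffineVariety k Z] {K L M : Type*} [Field K] [Field L] [Field M] [Algebra k K] [Algebra k L]
  [Algebra k M] [Algebra (coord k X) L] [Algebra (coord k Y) K] [Algebra (coord k Z) M]
  [IsScalarTower k (coord k X) L] [IsScalarTower k (coord k Y) K] [IsScalarTower k (coord k Z) M]
  [IsFractionRing (coord k X) L] [IsFractionRing (coord k Y) K] [IsFractionRing (coord k Z) M]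

variable (K L) in
/-- The embedding of function fields induced by a surjective morphism `f : X → Y`, for any
fields of fractions `K` of `k[Y]` and `L` of `k[X]`. -/
noncomputable def fracComap {f : X → Y} (hf : IsRegular k f) (hs : Function.Surjective f) :
    K →ₐ[k] L :=
  IsFractionRing.liftAlgHom (A := coord k Y) (K := K)
    (g := (Algebra.algHom k (coord k X) L).comp hf.comap) (by
      exact (IsFractionRing.injective (coord k X) L).comp (hf.comap_injective hs))

theorem fracComap_algebraMap {f : X → Y} (hf : IsRegular k f) (hs : Function.Surjective f)
    (a : coord k Y) :
    fracComap K L hf hs (algebraMap (coord k Y) K a) = algebraMap (coord k X) L (hf.comap a) := by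
  have hinj : Function.Injective ((algebraMap (coord k X) L).comp hf.comap.toRingHom) :=
    (IsFractionRing.injective (coord k X) L).comp (hf.comap_injective hs)
  exact IsFractionRing.lift_algebraMap hinj a

omit [IsScalarTower k (coord k Y) K] in
theorem fracComap_ext {L : Type*} [Field L] [Algebra k L] {φ ψ : K →ₐ[k] L}
    (h : ∀ a : coord k Y, φ (algebraMap _ _ a) = ψ (algebraMap _ _ a)) : φ = ψ := by
  apply AlgHom.coe_ringHom_injective
  exact IsLocalization.ringHom_ext (nonZeroDivisors (coord k Y)) (RingHom.ext h)

theorem fracComap_comp {f : X → Y} (hf : IsRegular k f) (hs : Function.Surjective f)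
    {g : Y → Z} (hg : IsRegular k g) (hgs : Function.Surjective g)
    {h : X → Z} (hh : IsRegular k h) (hhs : Function.Surjective h) (hcomp : ∀ x, g (f x) = h x)
    (θ : M) : fracComap K L hf hs (fracComap M K hg hgs θ) = fracComap M L hh hhs θ := by
  suffices (fracComap K L hf hs).comp (fracComap M K hg hgs) = fracComap M L hh hhs from
    DFunLike.congr_fun this θ
  refine fracComap_ext (Y := Z) fun a => ?_
  rw [AlgHom.comp_apply, fracComap_algebraMap, fracComap_algebraMap, fracComap_algebraMap]
  exact congrArg _ (Subtype.ext (funext fun x => congrArg a.1 (hcomp x)))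

theorem fracComap_of_eq_id {f : X → X} (hf : IsRegular k f) (hs : Function.Surjective f)
    (h : ∀ x, f x = x) (θ : L) : fracComap L L hf hs θ = θ := by
  suffices fracComap L L hf hs = AlgHom.id k _ from DFunLike.congr_fun this θ
  refine fracComap_ext (Y := X) fun a => ?_
  rw [fracComap_algebraMap]
  exact congrArg _ (Subtype.ext (funext fun x => congrArg a.1 (h x)))

end FracComap

theorem exists_point {k : Type*} [Field k] {X : Type*} [AffineVariety k X]
    (χ : coord k X →ₐ[k] k) : ∃ x : X, ∀ f : coord k X, χ f = f.1 x := by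
  obtain ⟨x, rfl⟩ := (AffineVariety.eval_bijective (k := k) (X := X)).2 χ
  exact ⟨x, fun _ => rfl⟩

theorem eq_of_forall_coord (k : Type*) [Field k] {X : Type*} [AffineVariety k X] {x y : X}
    (h : ∀ f : coord k X, f.1 x = f.1 y) : x = y :=
  (AffineVariety.eval_bijective (k := k) (X := X)).1 (AlgHom.ext h)

instance finiteType_coord (k : Type*) [Field k] (X : Type*) [AffineVariety k X] :
    Algebra.FiniteType k (coord k X) :=
  (Subalgebra.fg_iff_finiteType _).1 AffineVariety.fg

/-! ### The degree of an isogeny -/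

section Isogeny

variable {k : Type*} [Field k] {G H : Type*} [Group G] [Group H] [LinearAlgebraicGroup k G]
  [LinearAlgebraicGroup k H] [ZariskiConnected k G] [ZariskiConnected k H] {π : G →* H}

variable {L K : Type*} [Field L] [Algebra k L] [Algebra (coord k G) L]
  [IsScalarTower k (coord k G) L] [IsFractionRing (coord k G) L] [Field K] [Algebra k K]
  [Algebra (coord k H) K] [IsScalarTower k (coord k H) K] [IsFractionRing (coord k H) K]

omit [ZariskiConnected k G] [ZariskiConnected k H] in
-- Points `x`, `y` with the same image differ by right translation by `x⁻¹ * y`, an element of the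
-- kernel. Invariance of `b / c` under it, evaluated at `x`, is the cross-multiplied equality
-- required for descent.
theorem fracComap_mul_right_fixed_mem_range [IsAlgClosed k] [CharZero k] (hπ : IsRegular k π)
    (hs : Function.Surjective π) (θ : L)
    (h : ∀ κ ∈ π.ker, fracComap L L (regular_mul_right (k := k) κ)
      (Group.mulRight_bijective κ).2 θ = θ) : θ ∈ (fracComap K L hπ hs).fieldRange := by
  obtain ⟨b, c, hc, rfl⟩ := IsFractionRing.div_surjective (A := coord k G) θ
  have hinjL := IsFractionRing.injective (coord k G) L
  have hc' : algebraMap (coord k G) L c ≠ 0 := fun h0 =>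
    nonZeroDivisors.ne_zero hc (hinjL (h0.trans (map_zero _).symm))
  refine div_mem_fieldRange_of_forall_algHom hπ.comap (fracComap K L hπ hs)
    (fracComap_algebraMap hπ hs) b c hc' ?_
  intro χ₁ χ₂ hχ
  obtain ⟨x, hx⟩ := exists_point χ₁
  obtain ⟨y, hy⟩ := exists_point χ₂
  have hxy : π x = π y := eq_of_forall_coord k fun a => by
    have := hχ a
    rwa [hx, hy] at this
  have hκ : x⁻¹ * y ∈ π.ker := by
    rw [MonoidHom.mem_ker, map_mul, map_inv, hxy, inv_mul_cancel]
  have h1 := h _ hκ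
  have hinj := (regular_mul_right (k := k) (x⁻¹ * y)).comap_injective
    (Group.mulRight_bijective (x⁻¹ * y)).2
  rw [map_div₀, fracComap_algebraMap, fracComap_algebraMap, div_eq_div_iff _ hc', ← map_mul,
    ← map_mul] at h1
  · have h2 := congrFun (congrArg Subtype.val (hinjL h1)) x
    change b.1 (x * (x⁻¹ * y)) * c.1 x = b.1 x * c.1 (x * (x⁻¹ * y)) at h2
    rw [mul_inv_cancel_left] at h2
    rw [hx, hx, hy, hy, ← h2, mul_comm]
  · intro h0
    have h2 := hinjL (h0.trans (map_zero _).symm)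
    exact nonZeroDivisors.ne_zero hc (hinj (h2.trans (map_zero _).symm))

omit [ZariskiConnected k G] [ZariskiConnected k H] in
variable (L K) in
/-- The degree of an isogeny is at most the order of its kernel. -/
theorem rank_fieldRange_le_card_ker [IsAlgClosed k] [CharZero k] (hπ : IsIsogeny k π) :
    Module.rank (fracComap K L hπ.regular hπ.surjective).fieldRange L ≤ Nat.card π.ker := by
  have := hπ.finite_ker
  refine rank_le_card_of_forall_fixed (M := π.ker) (fun κ => fracComap L L
    (regular_mul_right (k := k) (κ : G)) (Group.mulRight_bijective (κ : G)).2) ?_ ?_ _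
    fun θ hθ => ?_
  · exact fun θ => fracComap_of_eq_id _ _ (fun x => mul_one x) θ
  · exact fun κ κ' θ => (fracComap_comp _ _ _ _ _ _ (fun x => mul_assoc x _ _) θ).symm
  · exact fracComap_mul_right_fixed_mem_range (K := K) hπ.regular hπ.surjective θ fun κ hκ => hθ ⟨κ, hκ⟩

omit [ZariskiConnected k G] [ZariskiConnected k H] in
variable (L K) in
theorem rank_fieldRange_lt_aleph0 [IsAlgClosed k] [CharZero k] (hπ : IsIsogeny k π) :
    Module.rank (fracComap K L hπ.regular hπ.surjective).fieldRange L < Cardinal.aleph0 :=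
  (rank_fieldRange_le_card_ker L K hπ).trans_lt Cardinal.natCast_lt_aleph0

end Isogeny

/-! ### Left-invariant derivations -/

section LeftInvariant

variable {k : Type*} [Field k] {G H : Type*} [Group G] [Group H] [LinearAlgebraicGroup k G]
  [LinearAlgebraicGroup k H]

theorem derivation_const (D : LieAlg k G) (r : k) : D.1 (algebraMap k (coord k G) r) = 0 := by
  have h : D.1 (1 : coord k G) = 0 := by
    have h1 := D.2 1 1
    rw [mul_one] at h1
    change D.1 1 = 1 * D.1 1 + 1 * D.1 1 at h1
    linear_combination -h1
  rw [Algebra.algebraMap_eq_smul_one, map_smul, h, smul_zero]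

/-- On generators the result is constant in `x`; the Leibniz rule at `y = 1` carries regularity to
products. This lets left-invariant derivations take values in `k[G]`. -/
theorem apply_slice_mem_coord (D : LieAlg k G) {F : G × G → k} (hF : F ∈ prodCoord k G G) :
    (fun x => D.1 ⟨fun y => F (x, y), slice_left hF x⟩) ∈ coord k G := by
  have hsub := hF
  induction hF using Algebra.adjoin_induction with
  | mem F hF =>
    rcases hF with ⟨f, hf, rfl⟩ | ⟨f, hf, rfl⟩
    · convert (coord k G).zero_mem using 1
      funext x
      exact derivation_const D (f x)
    · exact (coord k G).algebraMap_mem (D.1 ⟨f, hf⟩)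
  | algebraMap r =>
    convert (coord k G).zero_mem using 1
    funext x
    exact derivation_const D r
  | add F F' hF hF' h₁ h₂ =>
    convert (coord k G).add_mem (h₁ hF) (h₂ hF') using 1
    funext x
    exact D.1.map_add ⟨fun y => F (x, y), slice_left hF x⟩ ⟨fun y => F' (x, y), slice_left hF' x⟩
  | mul F F' hF hF' h₁ h₂ =>
    convert (coord k G).add_mem ((coord k G).mul_mem (slice_right hF 1) (h₂ hF'))
      ((coord k G).mul_mem (slice_right hF' 1) (h₁ hF)) using 1
    funext x
    exact D.2 ⟨fun y => F (x, y), slice_left hF x⟩ ⟨fun y => F' (x, y), slice_left hF' x⟩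

/-- The left-invariant derivation of `k[G]` with value `D` at `1`. -/
def leftInvariant (D : LieAlg k G) : Derivation k (coord k G) (coord k G) := 
  Derivation.mk' 
    { toFun := fun f => ⟨fun x => D.1 ((regular_mul_left x).comap f),
        apply_slice_mem_coord D (LinearAlgebraicGroup.mul_regular f.1 f.2)⟩
      map_add' := fun f g => Subtype.ext (funext fun x => by
        change D.1 (_) = D.1 _ + D.1 _
        rw [map_add, map_add])
      map_smul' := fun c f => Subtype.ext (funext fun x => by
        change D.1 (_) = c • D.1 _
        rw [map_smul, map_smul]) } fun f g => Subtype.ext (funext fun x => by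
        change D.1 (_) = f.1 x * D.1 _ + g.1 x * D.1 _
        rw [map_mul, D.2]
        change f.1 (x * 1) * _ + g.1 (x * 1) * _ = _
        rw [mul_one])

theorem leftInvariant_apply (D : LieAlg k G) (f : coord k G) (x : G) :
    (leftInvariant D f).1 x = D.1 ((regular_mul_left x).comap f) := rfl

theorem leftInvariant_apply_one (D : LieAlg k G) (f : coord k G) :
    (leftInvariant D f).1 1 = D.1 f := by
  rw [leftInvariant_apply]
  congr 1
  exact Subtype.ext (funext fun y => congrArg f.1 (one_mul y))

theorem leftInvariant_comap_mul_left (D : LieAlg k G) (f : coord k G) (g : G) :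
    leftInvariant D ((regular_mul_left g).comap f) =
      (regular_mul_left g).comap (leftInvariant D f) := by
  refine Subtype.ext (funext fun x => ?_)
  change D.1 _ = D.1 _
  congr 1
  exact Subtype.ext (funext fun y => congrArg f.1 (mul_assoc g x y).symm)

/-- Multiplicativity of `π` makes the left-invariant derivations of `D` and of its image under `dπ`
correspond, so statements on `dπ` become statements on extending derivations. -/
theorem leftInvariant_comap (π : G →* H) (hπ : IsRegular k π) (D : LieAlg k G) (h : coord k H) :
    leftInvariant D (hπ.comap h) = hπ.comap (leftInvariant (differential π hπ D) h) := by
  refine Subtype.ext (funext fun x => ?_)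
  change D.1 _ = D.1 _
  congr 1
  exact Subtype.ext (funext fun y => congrArg h.1 (map_mul π x y))

end LeftInvariant

/-! ### The differential of an isogeny is bijective -/

section Differential

variable {k : Type*} [Field k] {G H : Type*} [Group G] [Group H] [LinearAlgebraicGroup k G]
  [LinearAlgebraicGroup k H] [ZariskiConnected k G] [ZariskiConnected k H] {π : G →* H}


/-- If `dπ` kills `D`, the left-invariant derivation of `D` vanishes on `k[H]`, so by uniqueness of
extensions it vanishes on `k(G)`. -/
theorem differential_injective (L K : Type*) [Field L] [Algebra k L] [Algebra (coord k G) L]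
    [IsScalarTower k (coord k G) L] [IsFractionRing (coord k G) L] [Field K] [Algebra k K]
    [Algebra (coord k H) K] [IsScalarTower k (coord k H) K] [IsFractionRing (coord k H) K]
    [IsAlgClosed k] [CharZero k] (hπ : IsIsogeny k π) :
    Function.Injective (differential π hπ.regular) := by
  rw [injective_iff_map_eq_zero]
  intro D hD
  obtain ⟨D', hD'⟩ := exists_derivation_fractionRing (L := L) (leftInvariant D)
  have h0 : D' = 0 := by
    refine derivation_ext_of_rank_fieldRange_lt
      ((Algebra.algHom k (coord k G) (L)).comp hπ.regular.comap)
      (fracComap K L hπ.regular hπ.surjective)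
      (fracComap_algebraMap hπ.regular hπ.surjective) (rank_fieldRange_lt_aleph0 L K hπ) fun a => ?_
    have h1 : leftInvariant D (hπ.regular.comap a) = 0 := by
      rw [leftInvariant_comap, hD]
      rfl
    exact (hD' _).trans ((congrArg (algebraMap (coord k G) L) h1).trans (map_zero _))
  refine Subtype.ext (LinearMap.ext fun b => ?_)
  have h2 := hD' b
  rw [h0, Derivation.zero_apply, eq_comm] at h2
  replace h2 := IsFractionRing.injective (coord k G) L (h2.trans (map_zero _).symm)
  rw [← leftInvariant_apply_one, h2]
  rfl

variable {L : Type*} [Field L] [Algebra k L] [Algebra (coord k G) L]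
  [IsScalarTower k (coord k G) L] [IsFractionRing (coord k G) L]

variable (k L) in
/-- Left translation by `g` on `k(G)`. -/
noncomputable def leftTranslate (g : G) : L →ₐ[k] L :=
  fracComap L L (regular_mul_left (k := k) g) (Group.mulLeft_bijective g).2

omit [ZariskiConnected k G] in
theorem leftTranslate_algebraMap (g : G) (b : coord k G) :
    leftTranslate k L g (algebraMap _ (L) b) =
      algebraMap _ (L) ((regular_mul_left g).comap b) :=
  fracComap_algebraMap _ _ b

omit [ZariskiConnected k G] in
theorem leftTranslate_inv_apply (g : G) (θ : L) :
    leftTranslate k L g⁻¹ (leftTranslate k L g θ) = θ :=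
  (fracComap_comp (h := fun x : G => 1 * x) _ _ _ _ (regular_mul_left 1)
    (Group.mulLeft_bijective 1).2 (fun x => by group) θ).trans
    (fracComap_of_eq_id _ _ (fun x => one_mul x) θ)

omit [ZariskiConnected k G] in
theorem leftTranslate_apply_inv (g : G) (θ : L) :
    leftTranslate k L g (leftTranslate k L g⁻¹ θ) = θ := by
  simpa using leftTranslate_inv_apply g⁻¹ θ

/-- A derivation of `k(G)` that commutes with left translations preserves `k[G]`. -/
theorem derivation_mem_range_of_commute_leftTranslate [IsAlgClosed k]
    (D : Derivation k (L) (L))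
    (hD : ∀ (g : G) (θ : L), D (leftTranslate k L g θ) = leftTranslate k L g (D θ)) (b : coord k G) :
    D (algebraMap _ _ b) ∈ (algebraMap (coord k G) (L)).range := by
  -- The ideal of common denominators of `D` on `k[G]`. If proper, it has a common zero `y`.
  let I : Ideal (coord k G) :=
    { carrier := {c | ∀ b : coord k G, algebraMap _ (L) c * D (algebraMap _ _ b) ∈
        (algebraMap (coord k G) (L)).range}
      add_mem' := fun {x y} hx hy b => by
        rw [map_add, add_mul]
        exact add_mem (hx b) (hy b)
      zero_mem' := fun b => by
        rw [map_zero, zero_mul]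
        exact zero_mem _
      smul_mem' := fun c x hx b => by
        rw [smul_eq_mul, map_mul, mul_assoc]
        exact mul_mem ⟨c, rfl⟩ (hx b) }
  suffices hI : I = ⊤ by
    have h1 : (1 : coord k G) ∈ I := by
      rw [hI]
      trivial
    have h2 := h1 b
    rwa [map_one, one_mul] at h2
  by_contra hI
  obtain ⟨m, hm, hIm⟩ := Ideal.exists_le_maximal I hI
  obtain ⟨χ, hχ⟩ := exists_algHom_of_isMaximal (k := k) m
  obtain ⟨y, hy⟩ := exists_point χ
  obtain ⟨c, hc0, hc⟩ := exists_denominator_derivation (B := coord k G) D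
  obtain ⟨x, hx⟩ : ∃ x, c.1 x ≠ 0 := by
    by_contra! h
    exact hc0 (Subtype.ext (funext h))
  -- This ideal is stable under translation. Translating a denominator `c` with `c x ≠ 0` by `x *
  -- y⁻¹` gives a member that does not vanish at `y`.
  have hmem : (regular_mul_left (x * y⁻¹)).comap c ∈ I := fun b => by
    rw [← leftTranslate_algebraMap (k := k) (L := L), ← leftTranslate_apply_inv (k := k) (x * y⁻¹) (D (algebraMap _ _ b)),
      ← hD, ← map_mul, leftTranslate_algebraMap]
    obtain ⟨a, ha⟩ := hc ((regular_mul_left (x * y⁻¹)⁻¹).comap b)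
    rw [← ha, leftTranslate_algebraMap]
    exact ⟨_, rfl⟩
  have h0 := hχ _ (hIm hmem)
  rw [hy] at h0
  change c.1 (x * y⁻¹ * y) = 0 at h0
  rw [inv_mul_cancel_right] at h0
  exact hx h0

/-- The left-invariant derivation of `E` extends to `k(G)`, the extension preserves `k[G]`, and its
value at `1` is the required preimage. -/
theorem differential_surjective (L K : Type*) [Field L] [Algebra k L] [Algebra (coord k G) L]
    [IsScalarTower k (coord k G) L] [IsFractionRing (coord k G) L] [Field K] [Algebra k K]
    [Algebra (coord k H) K] [IsScalarTower k (coord k H) K] [IsFractionRing (coord k H) K]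
    [IsAlgClosed k] [CharZero k] (hπ : IsIsogeny k π) :
    Function.Surjective (differential π hπ.regular) := by
  intro E
  let r := (Algebra.algHom k (coord k G) (L)).comp hπ.regular.comap
  have hr : ∀ a, fracComap K L hπ.regular hπ.surjective (algebraMap _ _ a) = r a :=
    fracComap_algebraMap hπ.regular hπ.surjective
  obtain ⟨D, hD⟩ := exists_derivation_of_rank_fieldRange_lt r
    (fracComap K L hπ.regular hπ.surjective) hr (rank_fieldRange_lt_aleph0 L K hπ) (leftInvariant E)
  have hT : ∀ (g : G) a, leftTranslate k L g (r a) = r ((regular_mul_left (π g)).comap a) :=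
    fun g a => (leftTranslate_algebraMap g _).trans (congrArg _ (Subtype.ext (funext fun x =>
      congrArg a.1 (map_mul π g x))))
  have hcomm : ∀ (g : G) (θ : L), D (leftTranslate k L g θ) = leftTranslate k L g (D θ) := by
    intro g θ
    -- The conjugate of `D` by translation by `g` agrees with `D` on `k[H]`, because `D` restricts
    -- there to a left-invariant derivation; uniqueness of extensions makes them equal.
    have h1 : conjDerivation D (leftTranslate k L g) (leftTranslate k L g⁻¹)
        (leftTranslate_inv_apply g) = D := by
      refine derivation_ext_of_rank_fieldRange_lt r (fracComap K L hπ.regular hπ.surjective) hr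
        (rank_fieldRange_lt_aleph0 L K hπ) fun a => ?_
      change leftTranslate k L g⁻¹ (D (leftTranslate k L g (r a))) = D (r a)
      rw [hT, hD, hD, leftInvariant_comap_mul_left, ← hT, leftTranslate_inv_apply]
    have h2 : leftTranslate k L g⁻¹ (D (leftTranslate k L g θ)) = D θ := DFunLike.congr_fun h1 θ
    rw [← h2, leftTranslate_apply_inv]
  obtain ⟨d, hd⟩ := exists_derivation_of_forall_mem_range
    (IsFractionRing.injective (coord k G) (L)) D
    (derivation_mem_range_of_commute_leftTranslate D hcomm)
  have hdr : ∀ a, d (hπ.regular.comap a) = hπ.regular.comap (leftInvariant E a) := fun a =>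
    IsFractionRing.injective (coord k G) (L) ((hd _).trans (hD a))
  refine ⟨⟨(Pi.evalAlgHom k (fun _ : G => k) 1).toLinearMap ∘ₗ (coord k G).val.toLinearMap ∘ₗ
    d.toLinearMap, fun a b => ?_⟩, Subtype.ext (LinearMap.ext fun a => ?_)⟩
  · change (d (a * b)).1 1 = a.1 1 * (d b).1 1 + b.1 1 * (d a).1 1
    rw [d.leibniz]
    rfl
  · change (d (hπ.regular.comap a)).1 1 = E.1 a
    rw [hdr, ← leftInvariant_apply_one]
    exact congrArg (leftInvariant E a).1 (map_one π)

variable (k) in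
theorem differential_bijective [IsAlgClosed k] [CharZero k] (hπ : IsIsogeny k π) :
    Function.Bijective (differential π hπ.regular) :=
  ⟨differential_injective (FunField k G) (FunField k H) hπ,
    differential_surjective (FunField k G) (FunField k H) hπ⟩

end Differential

/-! ### Fields generated by symmetric algebras -/

section FractionField

open IntermediateField Cardinal

variable {k S K L : Type*} [Field k] [CommRing S] [Algebra k S] [Field K] [Algebra k K] [Field L]
  [Algebra k L]

theorem exists_algEquiv_fractionRing {f : S →ₐ[k] L} (hf : Function.Injective f)
    (h : adjoin k (Set.range f) = ⊤) :
    ∃ e : FractionRing S ≃ₐ[k] L, ∀ p, e (algebraMap _ _ p) = f p := by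
  have : IsDomain S := hf.isDomain f.toRingHom
  let g : FractionRing S →ₐ[k] L := IsFractionRing.liftAlgHom hf
  have hg : ∀ p, g (algebraMap S (FractionRing S) p) = f p := fun p =>
    IsFractionRing.lift_algebraMap (g := f.toRingHom) hf p
  have hsurj : Function.Surjective g := by
    rw [← AlgHom.fieldRange_eq_top, eq_top_iff, ← h, adjoin_le_iff]
    rintro _ ⟨p, rfl⟩
    exact ⟨_, hg p⟩
  exact ⟨AlgEquiv.ofBijective g ⟨g.toRingHom.injective, hsurj⟩, hg⟩

theorem injective_of_algEquiv_fractionRing {f : S →ₐ[k] L} {e : FractionRing S ≃ₐ[k] L}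
    (he : ∀ p, e (algebraMap _ _ p) = f p) : Function.Injective f := by
  intro p q hpq
  rw [← he, ← he] at hpq
  exact IsFractionRing.injective S (FractionRing S) (e.injective hpq)

theorem adjoin_range_of_algEquiv_fractionRing {f : S →ₐ[k] L} {e : FractionRing S ≃ₐ[k] L}
    (he : ∀ p, e (algebraMap _ _ p) = f p) : adjoin k (Set.range f) = ⊤ := by
  rw [eq_top_iff]
  intro y _
  obtain ⟨x, rfl⟩ := e.surjective y
  obtain ⟨p, q, rfl⟩ := IsLocalization.exists_mk'_eq (nonZeroDivisors S) x
  have hu : IsUnit (f q) := by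
    rw [← he]
    exact (IsLocalization.map_units (FractionRing S) q).map e
  have h1 := congrArg e (IsLocalization.mk'_spec (FractionRing S) p q)
  rw [map_mul, he, he] at h1
  rw [eq_div_of_mul_eq hu.ne_zero h1]
  exact div_mem (subset_adjoin k _ ⟨p, rfl⟩) (subset_adjoin k _ ⟨q, rfl⟩)

/-- Multiplicativity in the tower `ρ(F) ⊆ ρ(K) ⊆ L`; passing to `toENat` removes the universe lifts.
-/
theorem toENat_rank_map (ρ : K →ₐ[k] L) (F : IntermediateField k K) :
    toENat (Module.rank (F.map ρ) L) =
      toENat (Module.rank F K) * toENat (Module.rank ρ.fieldRange L) := by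
  have h1 : F.map ρ ≤ (⊤ : IntermediateField k K).map ρ := map_mono ρ le_top
  have h2 := congrArg toENat (lift_relrank_map_map F ⊤ ρ)
  rw [toENat_lift, toENat_lift, relrank_top_right] at h2
  rw [← relrank_mul_rank_top h1, map_mul, h2, ← AlgHom.fieldRange_eq_map]

theorem eq_top_of_rank_le_one {F : IntermediateField k L} (h : Module.rank F L ≤ 1) : F = ⊤ := by
  rw [eq_top_iff, ← relrank_eq_one_iff, relrank_top_right]
  exact le_antisymm h (Cardinal.one_le_iff_pos.2 rank_pos)

theorem rank_top_eq_one : Module.rank (⊤ : IntermediateField k L) L = 1 := by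
  rw [← relrank_top_right, relrank_eq_one_iff]

variable {V : Type*} [AddCommGroup V] [Module k V]

theorem adjoin_range_symmetricAlgebra_lift (f : V →ₗ[k] L) :
    adjoin k (Set.range (SymmetricAlgebra.lift f)) = adjoin k (Set.range f) := by
  apply le_antisymm
  · rw [adjoin_le_iff]
    rintro _ ⟨p, rfl⟩
    induction p using SymmetricAlgebra.induction with
    | algebraMap r =>
      rw [AlgHom.commutes]
      exact IntermediateField.algebraMap_mem _ r
    | ι x =>
      rw [SymmetricAlgebra.lift_ι_apply]
      exact subset_adjoin k _ ⟨x, rfl⟩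
    | mul a b ha hb =>
      rw [map_mul]
      exact mul_mem ha hb
    | add a b ha hb =>
      rw [map_add]
      exact add_mem ha hb
  · rw [adjoin_le_iff]
    rintro _ ⟨x, rfl⟩
    exact subset_adjoin k _ ⟨SymmetricAlgebra.ι k V x, SymmetricAlgebra.lift_ι_apply _ x⟩

/-- A basis identifies the symmetric algebra with a polynomial ring. Dominance thus becomes
algebraic independence of coordinates. -/
theorem injective_symmetricAlgebra_lift_iff {κ : Type*} (b : Module.Basis κ k V) (f : V →ₗ[k] L) :
    Function.Injective (SymmetricAlgebra.lift f) ↔ AlgebraicIndependent k (f ∘ b) := by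
  have h : SymmetricAlgebra.lift f = (MvPolynomial.aeval (f ∘ b)).comp
      (SymmetricAlgebra.equivMvPolynomial b).toAlgHom := by
    apply SymmetricAlgebra.algHom_ext
    refine b.ext fun i => ?_
    simp
  rw [h, AlgebraicIndependent]
  exact EquivLike.injective_comp (SymmetricAlgebra.equivMvPolynomial b)
    (MvPolynomial.aeval (R := k) (f ∘ b))

theorem injective_symmetricAlgebra_lift_comp {W : Type*} [AddCommGroup W] [Module k W]
    (e : W ≃ₗ[k] V) {f : V →ₗ[k] K} (hf : Function.Injective (SymmetricAlgebra.lift f))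
    (ρ : K →ₐ[k] L) :
    Function.Injective (SymmetricAlgebra.lift (ρ.toLinearMap ∘ₗ f ∘ₗ e.toLinearMap)) := by
  let b := Module.Basis.ofVectorSpace k W
  have h1 := (injective_symmetricAlgebra_lift_iff (b.map e) f).1 hf
  exact (injective_symmetricAlgebra_lift_iff b _).2 (h1.map' (f := ρ) ρ.toRingHom.injective)

theorem adjoin_range_symmetricAlgebra_lift_comp {W : Type*} [AddCommGroup W] [Module k W]
    (e : W ≃ₗ[k] V) (f : V →ₗ[k] K) (ρ : K →ₐ[k] L) :
    adjoin k (Set.range (SymmetricAlgebra.lift (ρ.toLinearMap ∘ₗ f ∘ₗ e.toLinearMap))) =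
      (adjoin k (Set.range (SymmetricAlgebra.lift f))).map ρ := by
  rw [adjoin_range_symmetricAlgebra_lift, adjoin_range_symmetricAlgebra_lift, adjoin_map,
    ← Set.range_comp]
  congr 1
  exact e.surjective.range_comp (ρ ∘ f)

end FractionField

/-! ### Composition of rational maps -/

section RatMapComp

open IntermediateField Cardinal

variable {k : Type*} [Field k] {X Y : Type*} [AffineVariety k X] [AffineVariety k Y]
  [IsDomain (coord k X)] [IsDomain (coord k Y)] {V W : Type*} [AddCommGroup V] [Module k V]
  [AddCommGroup W] [Module k W]

namespace RatMap

/-- The composite `X → Y ⇢ V ≃ W` of a rational map with a morphism and (the dual of) a linear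
isomorphism. -/
noncomputable def comp (φ : RatMap k Y V) (e : Module.Dual k W ≃ₗ[k] Module.Dual k V)
    (ρ : FunField k Y →ₐ[k] FunField k X) : RatMap k X W :=
  ρ.toLinearMap ∘ₗ φ ∘ₗ e.toLinearMap

variable (φ : RatMap k Y V) (e : Module.Dual k W ≃ₗ[k] Module.Dual k V)
    (ρ : FunField k Y →ₐ[k] FunField k X)

theorem IsDominant.comp {φ : RatMap k Y V} (hφ : φ.IsDominant) : (φ.comp e ρ).IsDominant := by
  have h1 : Function.Injective (SymmetricAlgebra.lift φ) := hφ
  have h2 := injective_symmetricAlgebra_lift_comp e h1 ρ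
  exact h2

theorem subfield_comp : (φ.comp e ρ).subfield = φ.subfield.map ρ := by
  have h2 := adjoin_range_symmetricAlgebra_lift_comp e φ ρ
  exact h2

theorem degree_comp : (φ.comp e ρ).degree =
    φ.degree * toENat (Module.rank ρ.fieldRange (FunField k X)) := by
  have h := toENat_rank_map ρ φ.subfield
  rw [← subfield_comp φ e ρ] at h
  exact h

end RatMap

end RatMapComp

/-! ### Pulling back generalized Cayley maps -/

section Pullback

open IntermediateField Cardinal

variable {k : Type*} [Field k] {G H : Type*} [Group G] [Group H] [LinearAlgebraicGroup k G]
  [LinearAlgebraicGroup k H] [ZariskiConnected k G] [ZariskiConnected k H] {π : G →* H}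

omit [ZariskiConnected k G] [ZariskiConnected k H] in
theorem differential_Ad (hπ : IsRegular k π) (g : G) (D : LieAlg k G) :
    differential π hπ (Ad g D) = Ad (π g) (differential π hπ D) := by
  refine Subtype.ext (LinearMap.ext fun a => ?_)
  change D.1 _ = D.1 _
  refine congrArg D.1 (Subtype.ext (funext fun x => congrArg a.1 ?_))
  change π (g * x * g⁻¹) = π g * π x * (π g)⁻¹
  rw [map_mul, map_mul, map_inv]

/-- The pullback `(dπ)⁻¹ ∘ φ ∘ π` of a rational map `φ : H ⇢ 𝔥` along `π : G → H`. -/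
noncomputable def pullback (hπ : IsRegular k π) (hs : Function.Surjective π)
    (hd : Function.Bijective (differential π hπ)) (φ : RatMap k H (LieAlg k H)) :
    RatMap k G (LieAlg k G) :=
  φ.comp (LinearEquiv.ofBijective (differential π hπ) hd).symm.dualMap (fieldComap π hπ hs)

variable (hπ : IsRegular k π) (hs : Function.Surjective π)
    (hd : Function.Bijective (differential π hπ)) {φ : RatMap k H (LieAlg k H)}

theorem pullback_isEquivariant (hφ : IsEquivariant φ) : IsEquivariant (pullback hπ hs hd φ) := by
  intro g l
  let e := LinearEquiv.ofBijective (differential π hπ) hd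
  have hl : (l ∘ₗ Ad g) ∘ₗ e.symm.toLinearMap = (l ∘ₗ e.symm.toLinearMap) ∘ₗ Ad (π g) := by
    refine LinearMap.ext fun E => ?_
    obtain ⟨D, rfl⟩ := e.surjective E
    change l (Ad g (e.symm (e D))) = l (e.symm (Ad (π g) (e D)))
    rw [e.symm_apply_apply]
    have : Ad (π g) (e D) = e (Ad g D) := (differential_Ad hπ g D).symm
    rw [this, e.symm_apply_apply]
  change fieldComap (k := k) (MulAut.conj g).toMonoidHom (regular_conj g)
    (MulAut.conj g).surjective (fieldComap π hπ hs (φ (l ∘ₗ e.symm.toLinearMap))) =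
    fieldComap π hπ hs (φ ((l ∘ₗ Ad g) ∘ₗ e.symm.toLinearMap))
  rw [hl, ← hφ (π g)]
  -- Both sides are pullbacks along `x ↦ π (g * x * g⁻¹)`, factored through conjugation on `G` or on
  -- `H`.
  have hreg : IsRegular k (fun x : G => π (g * x * g⁻¹)) := fun f hf =>
    regular_conj g _ (hπ f hf)
  have hsur : Function.Surjective (fun x : G => π (g * x * g⁻¹)) :=
    hs.comp (MulAut.conj g).surjective
  have h1 := fun θ => fracComap_comp (K := FunField k G) (L := FunField k G) (M := FunField k H)
    (regular_conj g) (MulAut.conj g).surjective hπ hs hreg hsur (fun x => rfl) θ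
  have h2 := fun θ => fracComap_comp (K := FunField k H) (L := FunField k G) (M := FunField k H)
    hπ hs (regular_conj (π g)) (MulAut.conj (π g)).surjective hreg hsur (fun x => by
      change π g * π x * (π g)⁻¹ = _
      rw [map_mul, map_mul, map_inv]) θ
  exact (h1 _).trans (h2 _).symm

theorem pullback_isGeneralizedCayleyMap (hφ : IsGeneralizedCayleyMap φ) :
    IsGeneralizedCayleyMap (pullback hπ hs hd φ) :=
  ⟨pullback_isEquivariant hπ hs hd hφ.1, hφ.2.comp _ _⟩

theorem pullback_degree (φ : RatMap k H (LieAlg k H)) :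
    (pullback hπ hs hd φ).degree =
      φ.degree * toENat (Module.rank (fieldComap π hπ hs).fieldRange (FunField k G)) :=
  φ.degree_comp _ _

end Pullback

/-! ### Bounds on the Cayley degree -/

section CayleyDegree

open IntermediateField Cardinal

variable {k : Type*} [Field k] {G H : Type*} [Group G] [Group H] [LinearAlgebraicGroup k G]
  [LinearAlgebraicGroup k H] [ZariskiConnected k G] [ZariskiConnected k H] {π : G →* H}

theorem isBirational_of_degree_le_one {φ : RatMap k G (LieAlg k G)} (hφ : φ.IsDominant)
    (h : φ.degree ≤ 1) : φ.IsBirational :=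
  exists_algEquiv_fractionRing hφ (eq_top_of_rank_le_one (toENat_le_one.1 h))

theorem isDominant_of_isBirational {φ : RatMap k G (LieAlg k G)} (hφ : φ.IsBirational) :
    φ.IsDominant :=
  injective_of_algEquiv_fractionRing hφ.choose_spec

theorem degree_of_isBirational {φ : RatMap k G (LieAlg k G)} (hφ : φ.IsBirational) :
    φ.degree = 1 := by
  have h : φ.subfield = ⊤ := adjoin_range_of_algEquiv_fractionRing hφ.choose_spec
  rw [RatMap.degree, h, rank_top_eq_one, map_one]

variable (k G) in
theorem two_le_cayleyDegree (hG : ¬ IsCayley k G) : 2 ≤ cayleyDegree k G := by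
  refine le_iInf fun φ => ?_
  by_contra! h
  have h1 : φ.1.degree ≤ 1 := Order.le_of_lt_add_one (by simpa [one_add_one_eq_two] using h)
  exact hG ⟨φ.1, φ.2.1, isBirational_of_degree_le_one φ.2.2 h1⟩

variable (k H) in
theorem cayleyDegree_le_one (hH : IsCayley k H) : cayleyDegree k H ≤ 1 := by
  obtain ⟨φ, hφ, hb⟩ := hH
  refine (iInf_le _ ⟨φ, hφ, isDominant_of_isBirational hb⟩).trans ?_
  rw [degree_of_isBirational hb]

theorem cayleyDegree_le_mul [IsAlgClosed k] [CharZero k] (hπ : IsIsogeny k π) :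
    cayleyDegree k G ≤ Nat.card π.ker * cayleyDegree k H := by
  have := hπ.finite_ker
  have hcard : (Nat.card π.ker : ℕ∞) ≠ 0 := by
    rw [Nat.cast_ne_zero]
    exact Nat.card_pos.ne'
  by_cases hne : Nonempty {φ : RatMap k H (LieAlg k H) // IsGeneralizedCayleyMap φ}
  -- A nonempty infimum in `ℕ∞` is attained, so a map of minimal degree can be pulled back.
  · obtain ⟨φ, hφ⟩ := ENat.exists_eq_iInf
      fun φ : {φ : RatMap k H (LieAlg k H) // IsGeneralizedCayleyMap φ} => φ.1.degree
    have hd := differential_bijective k hπ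
    rw [cayleyDegree, cayleyDegree, ← hφ]
    refine (iInf_le _ ⟨_, pullback_isGeneralizedCayleyMap hπ.regular hπ.surjective hd φ.2⟩).trans ?_
    rw [pullback_degree, mul_comm]
    gcongr
    exact toENat_le_natCast.2 (rank_fieldRange_le_card_ker (FunField k G) (FunField k H) hπ)
  -- Without generalized Cayley maps of `H` the infimum is `⊤`, and the nonzero factor keeps the
  -- product `⊤`.
  · rw [not_nonempty_iff] at hne
    have : cayleyDegree k H = ⊤ := iInf_of_empty _
    rw [this, ENat.mul_top hcard]
    exact le_top

end CayleyDegree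

/-! ### Sums of linear maps into linearly disjoint fields -/

section ProductField

open IntermediateField Cardinal

variable {k E : Type*} [Field k] [Field E] [Algebra k E] {ι : Type*} [Fintype ι] [DecidableEq ι]
  {K : ι → Type*} [∀ i, Field (K i)] [∀ i, Algebra k (K i)] {V : ι → Type*}
  [∀ i, AddCommGroup (V i)] [∀ i, Module k (V i)] {W : Type*} [AddCommGroup W] [Module k W]
  (e : W ≃ₗ[k] ∀ i, V i) {f : ∀ i, V i →ₗ[k] K i} {ρ : ∀ i, K i →ₐ[k] E} {F : W →ₗ[k] E}

theorem apply_eq_sum_of_single (hF : ∀ i v, F (e.symm (Pi.single i v)) = ρ i (f i v)) (w : W) :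
    F w = ∑ i, ρ i (f i (e w i)) := by
  conv_lhs => rw [← e.symm_apply_apply w, ← Finset.univ_sum_single (e w), map_sum, map_sum]
  exact Finset.sum_congr rfl fun i _ => hF i _

/-- A basis of `W` assembled from bases of the `V i` is sent by `F` to the union of the families
coming from the `f i`, which linear disjointness keeps algebraically independent. -/
theorem injective_lift_of_single (hF : ∀ i v, F (e.symm (Pi.single i v)) = ρ i (f i v))
    (H : ∀ (s : Finset ι) (j : ι), j ∉ s →
      (s.sup fun i => (ρ i).fieldRange).LinearDisjoint (ρ j).fieldRange)
    (hf : ∀ i, Function.Injective (SymmetricAlgebra.lift (f i))) :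
    Function.Injective (SymmetricAlgebra.lift F) := by
  let b := fun i => Module.Basis.ofVectorSpace k (V i)
  have hb : ∀ i, AlgebraicIndependent k (fun c => ρ i (f i (b i c))) := fun i =>
    ((injective_symmetricAlgebra_lift_iff (b i) (f i)).1 (hf i)).map' (f := ρ i)
      (ρ i).toRingHom.injective
  have h1 := algebraicIndependent_sigma_of_linearDisjoint (A := fun i => (ρ i).fieldRange)
    (fun i c => ρ i (f i (b i c))) (fun i c => ⟨_, rfl⟩) hb H Finset.univ
  have h2 := h1.comp (fun x : Σ i, Module.Basis.ofVectorSpaceIndex k (V i) =>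
    ⟨x, Finset.mem_univ _⟩) fun x y hxy => congrArg Subtype.val hxy
  refine (injective_symmetricAlgebra_lift_iff ((Pi.basis b).map e.symm) _).2 ?_
  convert h2 using 1
  funext x
  rw [Function.comp_apply, Module.Basis.map_apply, Pi.basis_apply, hF]
  rfl

theorem adjoin_range_lift_of_single
    (hF : ∀ i v, F (e.symm (Pi.single i v)) = ρ i (f i v)) :
    adjoin k (Set.range (SymmetricAlgebra.lift F)) =
      Finset.univ.sup fun i => (adjoin k (Set.range (SymmetricAlgebra.lift (f i)))).map (ρ i) := by
  simp only [adjoin_range_symmetricAlgebra_lift]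
  apply le_antisymm
  · rw [adjoin_le_iff]
    rintro _ ⟨w, rfl⟩
    rw [apply_eq_sum_of_single e hF]
    refine sum_mem fun i hi => ?_
    refine (Finset.le_sup (f := fun i => (adjoin k (Set.range (f i))).map (ρ i)) hi) ?_
    exact ⟨_, subset_adjoin k _ ⟨_, rfl⟩, rfl⟩
  · refine Finset.sup_le fun i _ => ?_
    rw [adjoin_map, adjoin_le_iff]
    rintro _ ⟨_, ⟨v, rfl⟩, rfl⟩
    exact subset_adjoin k _ ⟨_, hF i v⟩

theorem toENat_rank_sup_map
    (H : ∀ (s : Finset ι) (j : ι), j ∉ s →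
      (s.sup fun i => (ρ i).fieldRange).LinearDisjoint (ρ j).fieldRange)
    (htop : (Finset.univ.sup fun i => (ρ i).fieldRange) = ⊤) (F : ∀ i, IntermediateField k (K i)) :
    toENat (Module.rank (Finset.univ.sup fun i => (F i).map (ρ i) : IntermediateField k E) E) =
      ∏ i, toENat (Module.rank (F i) (K i)) := by
  have h1 : ∀ i, (F i).map (ρ i) ≤ (ρ i).fieldRange := fun i => by
    rw [AlgHom.fieldRange_eq_map]
    exact map_mono (ρ i) le_top
  rw [← relrank_top_right, ← htop, toENat_relrank_finset_sup h1 H]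
  refine Finset.prod_congr rfl fun i _ => ?_
  have h2 := congrArg toENat (lift_relrank_map_map (F i) ⊤ (ρ i))
  rw [toENat_lift, toENat_lift, relrank_top_right, ← AlgHom.fieldRange_eq_map] at h2
  exact h2

end ProductField

/-! ### Linear disjointness of coordinate rings in a product -/

section ProductCoord

/-- Two subalgebras `A`, `B` are linearly disjoint if there are enough homomorphisms that are
scalar-valued on `A` and injective on `B`. -/
theorem linearDisjoint_of_forall_algHom {k R S P : Type*} [Field k] [CommRing R] [Algebra k R]
    [CommRing S] [Algebra k S] {A B : Subalgebra k R} (σ : P → (R →ₐ[k] S)) (χ : P → R → k)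
    (hχ : ∀ a ∈ A, ∀ p, σ p a = algebraMap k S (χ p a)) (hA : ∀ a : R, (∀ p, χ p a = 0) → a = 0)
    (hB : ∀ p, ∀ b ∈ B, σ p b = 0 → b = 0) : A.LinearDisjoint B := by
  let b := Module.Basis.ofVectorSpace k B
  refine Subalgebra.LinearDisjoint.of_basis_right _ _ b ?_
  rw [linearIndependent_iff']
  intro T F hF i hi
  refine Subtype.ext (hA _ fun p => ?_)
  -- Applying `σ p` to a relation makes its coefficients scalars. Injectivity on `B` then gives a
  -- `k`-linear relation among basis vectors, so every coefficient is killed by all `χ p`.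
  refine linearIndependent_iff'.1 b.linearIndependent T (fun i => χ p (F i)) ?_ i hi
  refine Subtype.ext (hB p _ (Subtype.mem _) ?_)
  have h1 := congrArg (σ p) hF
  rw [map_sum, map_zero] at h1
  rw [AddSubmonoidClass.coe_finsetSum, map_sum, ← h1]
  refine Finset.sum_congr rfl fun i _ => ?_
  change σ p (χ p (F i) • (b i : R)) = σ p ((F i : R) * (b i : R))
  rw [map_smul, map_mul, hχ _ (F i).2, Algebra.smul_def]

variable {k : Type*} [Field k] {ι : Type*} [Finite ι] (X : ι → Type*) [∀ i, AffineVariety k (X i)]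

variable (k) in
/-- The regular functions on a product that depend only on the coordinates in `s`. -/
def coordOn (s : Set ι) : Subalgebra k (coord k (∀ i, X i)) where
  carrier := {F | ∀ x y, (∀ i ∈ s, x i = y i) → F.1 x = F.1 y}
  mul_mem' := fun ha hb x y h => congrArg₂ (· * ·) (ha x y h) (hb x y h)
  add_mem' := fun ha hb x y h => congrArg₂ (· + ·) (ha x y h) (hb x y h)
  algebraMap_mem' := fun _ _ _ _ => rfl

/-- Freezing the coordinates in `s` at a point `p` makes functions of these coordinates constant and
leaves functions of the coordinates in `t` unchanged. -/
theorem linearDisjoint_coordOn {s t : Set ι} (hst : Disjoint s t) :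
    (coordOn k X s).LinearDisjoint (coordOn k X t) := by
  classical
  let z : (∀ i, X i) → (∀ i, X i) → ∀ i, X i := fun p y i => if i ∈ s then p i else y i
  let σ : (∀ i, X i) → (coord k (∀ i, X i) →ₐ[k] ((∀ i, X i) → k)) := fun p =>
    (AlgHom.pi (R := k) fun y => Pi.evalAlgHom k (fun _ : ∀ i, X i => k) (z p y)).comp
      (coord k (∀ i, X i)).val
  refine linearDisjoint_of_forall_algHom σ (fun p a => a.1 p) (fun a ha p => ?_)
    (fun a ha => Subtype.ext (funext ha)) fun p b hb hb0 => ?_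
  · funext y
    exact ha (z p y) p fun j hj => if_pos hj
  · refine Subtype.ext (funext fun y => ?_)
    have h1 : b.1 (z p y) = b.1 y := hb (z p y) y fun j hj =>
      if_neg fun hjs => Set.disjoint_left.1 hst hjs hj
    rw [← h1]
    exact congrFun hb0 y

theorem comap_proj_mem_coordOn {s : Set ι} {i : ι} (hi : i ∈ s) (a : coord k (X i)) :
    (regular_proj X i).comap a ∈ coordOn k X s := fun _ _ h => congrArg a.1 (h i hi)

theorem adjoin_comap_proj_eq_top :
    Algebra.adjoin k (⋃ i, Set.range fun a : coord k (X i) => (regular_proj X i).comap a) = ⊤ := by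
  rw [eq_top_iff]
  rintro ⟨F, hF⟩ -
  change F ∈ Algebra.adjoin k _ at hF
  induction hF using Algebra.adjoin_induction with
  | mem F hF =>
    obtain ⟨i, h, hh, rfl⟩ := hF
    exact Algebra.subset_adjoin (Set.mem_iUnion.2 ⟨i, ⟨h, hh⟩, rfl⟩)
  | algebraMap r => exact Subalgebra.algebraMap_mem _ r
  | add a b ha hb h₁ h₂ => exact Subalgebra.add_mem _ h₁ h₂
  | mul a b ha hb h₁ h₂ => exact Subalgebra.mul_mem _ h₁ h₂

end ProductCoord

/-! ### Function fields of products -/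

section ProductFrac

open IntermediateField

theorem fieldRange_fracComap {k X Y : Type*} [Field k] [AffineVariety k X] [AffineVariety k Y]
    {K L : Type*} [Field K] [Field L] [Algebra k K] [Algebra k L]
    [Algebra (coord k X) L] [Algebra (coord k Y) K] [IsScalarTower k (coord k X) L]
    [IsScalarTower k (coord k Y) K] [IsFractionRing (coord k X) L] [IsFractionRing (coord k Y) K]
    {f : X → Y} (hf : IsRegular k f) (hs : Function.Surjective f) :
    (fracComap K L hf hs).fieldRange =
      adjoin k (Set.range fun a : coord k Y => algebraMap (coord k X) L (hf.comap a)) := by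
  apply le_antisymm
  · rintro _ ⟨θ, rfl⟩
    obtain ⟨a, b, -, rfl⟩ := IsFractionRing.div_surjective (A := coord k Y) θ
    have h : ∀ a : coord k Y, fracComap K L hf hs (algebraMap (coord k Y) K a) ∈
        adjoin k (Set.range fun a : coord k Y => algebraMap (coord k X) L (hf.comap a)) := fun a =>
      subset_adjoin k _ ⟨a, (fracComap_algebraMap hf hs a).symm⟩
    change fracComap K L hf hs _ ∈ _
    rw [map_div₀]
    exact div_mem (h a) (h b)
  · rw [adjoin_le_iff]
    rintro _ ⟨a, rfl⟩
    exact ⟨_, fracComap_algebraMap hf hs a⟩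

variable {k : Type*} [Field k] {ι : Type*} [Finite ι] {X : ι → Type*}
  [∀ i, AffineVariety k (X i)] {K : ι → Type*} [∀ i, Field (K i)] [∀ i, Algebra k (K i)]
  [∀ i, Algebra (coord k (X i)) (K i)] [∀ i, IsScalarTower k (coord k (X i)) (K i)]
  [∀ i, IsFractionRing (coord k (X i)) (K i)] {E : Type*} [Field E] [Algebra k E]
  [Algebra (coord k (∀ i, X i)) E] [IsScalarTower k (coord k (∀ i, X i)) E]
  [IsFractionRing (coord k (∀ i, X i)) E]
  (hs : ∀ i, Function.Surjective (fun x : ∀ i, X i => x i))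

theorem finset_sup_fieldRange_proj (s : Finset ι) :
    (s.sup fun i => (fracComap (K i) E (regular_proj (k := k) X i) (hs i)).fieldRange) =
      adjoin k (⋃ i ∈ s, Set.range fun a : coord k (X i) =>
        algebraMap (coord k (∀ i, X i)) E ((regular_proj X i).comap a)) := by
  simp only [fieldRange_fracComap]
  apply le_antisymm
  · exact Finset.sup_le fun i hi => adjoin.mono _ _ _ (Set.subset_biUnion_of_mem (u := fun i =>
      Set.range fun a : coord k (X i) =>
        algebraMap (coord k (∀ i, X i)) E ((regular_proj X i).comap a)) hi)
  · rw [adjoin_le_iff]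
    refine Set.iUnion₂_subset fun i hi => ?_
    exact (subset_adjoin k _).trans (Finset.le_sup (f := fun i => adjoin k (Set.range
      fun a : coord k (X i) => algebraMap (coord k (∀ i, X i)) E ((regular_proj X i).comap a))) hi)

theorem finset_univ_sup_fieldRange_proj [Fintype ι] :
    (Finset.univ.sup fun i => (fracComap (K i) E (regular_proj (k := k) X i) (hs i)).fieldRange) =
      ⊤ := by
  rw [finset_sup_fieldRange_proj, eq_top_iff]
  have h : ∀ a : coord k (∀ i, X i), algebraMap (coord k (∀ i, X i)) E a ∈
      adjoin k (⋃ i ∈ Finset.univ, Set.range fun a : coord k (X i) =>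
        algebraMap (coord k (∀ i, X i)) E ((regular_proj X i).comap a)) := fun a => by
    refine algebra_adjoin_le_adjoin k _ ?_
    have ha : a ∈ Algebra.adjoin k (⋃ i, Set.range fun a : coord k (X i) =>
        (regular_proj X i).comap a) := by
      rw [adjoin_comap_proj_eq_top]
      trivial
    have h1 : algebraMap (coord k (∀ i, X i)) E a ∈ Subalgebra.map
        (IsScalarTower.toAlgHom k (coord k (∀ i, X i)) E) (Algebra.adjoin k _) := ⟨a, ha, rfl⟩
    rw [AlgHom.map_adjoin] at h1
    refine Algebra.adjoin_mono ?_ h1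
    rintro _ ⟨b, hb, rfl⟩
    obtain ⟨i, c, rfl⟩ := Set.mem_iUnion.1 hb
    exact Set.mem_iUnion₂.2 ⟨i, Finset.mem_univ i, c, rfl⟩
  rintro θ -
  obtain ⟨a, b, -, rfl⟩ := IsFractionRing.div_surjective (A := coord k (∀ i, X i)) θ
  exact div_mem (h a) (h b)

theorem linearDisjoint_fieldRange_proj (s : Finset ι) (j : ι) (hj : j ∉ s) :
    (s.sup fun i => (fracComap (K i) E (regular_proj (k := k) X i) (hs i)).fieldRange).LinearDisjoint
      (fracComap (K j) E (regular_proj (k := k) X j) (hs j)).fieldRange := by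
  rw [finset_sup_fieldRange_proj, fieldRange_fracComap]
  refine linearDisjoint_adjoin ?_
  have h := (linearDisjoint_coordOn (k := k) X (s := (s : Set ι)) (t := {j})
    (Set.disjoint_singleton_right.2 hj)).map (IsScalarTower.toAlgHom k (coord k (∀ i, X i)) E)
    (IsFractionRing.injective (coord k (∀ i, X i)) E)
  refine h.of_le_of_flat_left ?_ ?_
  · refine Algebra.adjoin_le (Set.iUnion₂_subset fun i hi => ?_)
    rintro _ ⟨a, rfl⟩
    exact ⟨_, comap_proj_mem_coordOn X hi a, rfl⟩
  · refine Algebra.adjoin_le ?_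
    rintro _ ⟨a, rfl⟩
    exact ⟨_, comap_proj_mem_coordOn X (Set.mem_singleton j) a, rfl⟩

variable [Fintype ι] [DecidableEq ι] {V : ι → Type*} [∀ i, AddCommGroup (V i)]
  [∀ i, Module k (V i)] {W : Type*} [AddCommGroup W] [Module k W] (e : W ≃ₗ[k] ∀ i, V i)
  {f : ∀ i, V i →ₗ[k] K i} {F : W →ₗ[k] E}

theorem injective_lift_of_single_proj
    (hF : ∀ i v, F (e.symm (Pi.single i v)) =
      fracComap (K i) E (regular_proj (k := k) X i) (hs i) (f i v))
    (hf : ∀ i, Function.Injective (SymmetricAlgebra.lift (f i))) :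
    Function.Injective (SymmetricAlgebra.lift F) :=
  injective_lift_of_single e hF (linearDisjoint_fieldRange_proj hs) hf

theorem toENat_rank_adjoin_range_lift_of_single_proj
    (hF : ∀ i v, F (e.symm (Pi.single i v)) =
      fracComap (K i) E (regular_proj (k := k) X i) (hs i) (f i v)) :
    Cardinal.toENat (Module.rank (adjoin k (Set.range (SymmetricAlgebra.lift F))) E) =
      ∏ i, Cardinal.toENat
        (Module.rank (adjoin k (Set.range (SymmetricAlgebra.lift (f i)))) (K i)) := by
  rw [adjoin_range_lift_of_single e hF]
  exact toENat_rank_sup_map (linearDisjoint_fieldRange_proj hs) (finset_univ_sup_fieldRange_proj hs) _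

end ProductFrac

/-! ### The Lie algebra of a product -/

section ProductLie

variable {k : Type*} [Field k] {ι : Type*} [Fintype ι] [DecidableEq ι] {G : ι → Type*}
  [∀ i, Group (G i)] [∀ i, LinearAlgebraicGroup k (G i)]

variable (k G) in
/-- The differential of the inclusion of the `i`-th factor. -/
def lieSingle (i : ι) : LieAlg k (G i) →ₗ[k] LieAlg k (∀ i, G i) :=
  differential (MonoidHom.mulSingle G i) (regular_single G i)

variable (k G) in
/-- The differential of the projection to the `i`-th factor. -/
def lieProj (i : ι) : LieAlg k (∀ i, G i) →ₗ[k] LieAlg k (G i) :=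
  differential (Pi.evalMonoidHom G i) (regular_proj G i)

theorem lieProj_lieSingle_same (i : ι) (D : LieAlg k (G i)) :
    lieProj k G i (lieSingle k G i D) = D := by
  refine Subtype.ext (LinearMap.ext fun a => ?_)
  refine congrArg D.1 (Subtype.ext (funext fun x => congrArg a.1 ?_))
  exact Pi.mulSingle_eq_same i x

theorem lieProj_lieSingle_of_ne {i j : ι} (hij : i ≠ j) (D : LieAlg k (G j)) :
    lieProj k G i (lieSingle k G j D) = 0 := by
  refine Subtype.ext (LinearMap.ext fun a => ?_)
  have h : (regular_single G j).comap ((regular_proj G i).comap a) =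
      algebraMap k (coord k (G j)) (a.1 1) :=
    Subtype.ext (funext fun x => congrArg a.1 (Pi.mulSingle_eq_of_ne hij x))
  exact (congrArg D.1 h).trans (derivation_const D (a.1 1))

omit [DecidableEq ι] in
-- A point derivation is determined on generators of the coordinate ring, and these are pulled back
-- from the factors.
theorem lieAlg_pi_ext {D D' : LieAlg k (∀ i, G i)} (h : ∀ i, lieProj k G i D = lieProj k G i D') :
    D = D' := by
  refine Subtype.ext (LinearMap.ext ?_)
  rintro ⟨F, hF⟩
  have hF' := hF
  change F ∈ Algebra.adjoin k _ at hF'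
  induction hF' using Algebra.adjoin_induction with
  | mem F hF' =>
    obtain ⟨i, a, ha, rfl⟩ := hF'
    exact LinearMap.congr_fun (congrArg Subtype.val (h i)) ⟨a, ha⟩
  | algebraMap r => exact (derivation_const D r).trans (derivation_const D' r).symm
  | add a b ha hb h₁ h₂ =>
    have h3 := congrArg₂ (· + ·) (h₁ ha) (h₂ hb)
    exact (D.1.map_add ⟨a, ha⟩ ⟨b, hb⟩).trans (h3.trans (D'.1.map_add ⟨a, ha⟩ ⟨b, hb⟩).symm)
  | mul a b ha hb h₁ h₂ =>
    refine (D.2 ⟨a, ha⟩ ⟨b, hb⟩).trans (Eq.trans ?_ (D'.2 ⟨a, ha⟩ ⟨b, hb⟩).symm)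
    rw [h₁ ha, h₂ hb]

theorem sum_lieSingle_lieProj (D : LieAlg k (∀ i, G i)) :
    ∑ i, lieSingle k G i (lieProj k G i D) = D := by
  refine lieAlg_pi_ext fun j => ?_
  rw [map_sum, Finset.sum_eq_single j]
  · exact lieProj_lieSingle_same j _
  · exact fun i _ hij => lieProj_lieSingle_of_ne hij.symm _
  · exact fun hj => absurd (Finset.mem_univ j) hj

variable (k G) in
/-- The decomposition of linear forms on `Lie (G₁ × ⋯ × Gₙ) = 𝔤₁ ⊕ ⋯ ⊕ 𝔤ₙ`. -/
def lieDualEquiv : Module.Dual k (LieAlg k (∀ i, G i)) ≃ₗ[k] ∀ i, Module.Dual k (LieAlg k (G i)) where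
  toFun l i := l ∘ₗ lieSingle k G i
  map_add' _ _ := rfl
  map_smul' _ _ := rfl
  invFun m := ∑ i, m i ∘ₗ lieProj k G i
  left_inv l := by
    refine LinearMap.ext fun D => ?_
    rw [LinearMap.sum_apply]
    refine Eq.trans ?_ (congrArg l (sum_lieSingle_lieProj D))
    rw [map_sum]
    rfl
  right_inv m := by
    funext j
    refine LinearMap.ext fun D => ?_
    change (∑ i, m i ∘ₗ lieProj k G i) (lieSingle k G j D) = m j D
    rw [LinearMap.sum_apply, Finset.sum_eq_single j]
    · exact congrArg (m j) (lieProj_lieSingle_same j D)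
    · intro i _ hij
      exact (congrArg (m i) (lieProj_lieSingle_of_ne hij D)).trans (map_zero _)
    · exact fun hj => absurd (Finset.mem_univ j) hj

theorem Ad_lieSingle (g : ∀ i, G i) (i : ι) (D : LieAlg k (G i)) :
    Ad g (lieSingle k G i D) = lieSingle k G i (Ad (g i) D) := by
  refine Subtype.ext (LinearMap.ext fun a => ?_)
  refine congrArg D.1 (Subtype.ext (funext fun x => congrArg a.1 ?_))
  change g * Pi.mulSingle i x * g⁻¹ = Pi.mulSingle i (g i * x * (g i)⁻¹)
  funext j
  by_cases hj : j = i
  · subst hj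
    simp
  · simp [Pi.mulSingle_eq_of_ne hj]

end ProductLie

/-! ### Products of generalized Cayley maps -/

section ProductMap

variable {k : Type*} [Field k] {ι : Type*} [Fintype ι] [DecidableEq ι] {G : ι → Type*}
  [∀ i, Group (G i)] [∀ i, LinearAlgebraicGroup k (G i)] [∀ i, ZariskiConnected k (G i)]

theorem prodMap_apply (φ : ∀ i, RatMap k (G i) (LieAlg k (G i)))
    (l : Module.Dual k (LieAlg k (∀ i, G i))) :
    prodMap φ l = ∑ i, fieldComap (k := k) (fun x : ∀ i, G i => x i) (regular_proj G i)
      (Function.surjective_eval i) (φ i (l ∘ₗ lieSingle k G i)) := by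
  rw [prodMap, LinearMap.sum_apply]
  exact Finset.sum_congr rfl fun i _ => rfl

/-- This is the hypothesis `hF` under which the product-field results apply to `prodMap`. -/
theorem prodMap_lieDualEquiv_symm_single (φ : ∀ i, RatMap k (G i) (LieAlg k (G i))) (i : ι)
    (m : Module.Dual k (LieAlg k (G i))) :
    prodMap φ ((lieDualEquiv k G).symm (Pi.single i m)) =
      fieldComap (k := k) (fun x : ∀ i, G i => x i) (regular_proj G i) (Function.surjective_eval i)
        (φ i m) := by
  have h : ∀ j, (lieDualEquiv k G).symm (Pi.single i m) ∘ₗ lieSingle k G j =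
      Pi.single (M := fun i => Module.Dual k (LieAlg k (G i))) i m j := fun j =>
    congrFun ((lieDualEquiv k G).apply_symm_apply (Pi.single i m)) j
  rw [prodMap_apply, Finset.sum_eq_single i]
  · rw [h, Pi.single_eq_same]
  · intro j _ hj
    rw [h, Pi.single_eq_of_ne hj, map_zero, map_zero]
  · exact fun hi => absurd (Finset.mem_univ i) hi

theorem prodMap_isEquivariant {φ : ∀ i, RatMap k (G i) (LieAlg k (G i))}
    (hφ : ∀ i, IsEquivariant (φ i)) : IsEquivariant (prodMap φ) := by
  intro g l
  rw [prodMap_apply, prodMap_apply, map_sum]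
  refine Finset.sum_congr rfl fun i _ => ?_
  have hl : (l ∘ₗ Ad g) ∘ₗ lieSingle k G i = (l ∘ₗ lieSingle k G i) ∘ₗ Ad (g i) :=
    LinearMap.ext fun D => congrArg l (Ad_lieSingle g i D)
  rw [hl, ← hφ i (g i)]
  -- Both sides of the `i`-th summand are pullbacks along `x ↦ g i * x i * (g i)⁻¹`.
  have hreg : IsRegular k (fun x : ∀ i, G i => g i * x i * (g i)⁻¹) := fun f hf =>
    regular_proj G i _ (regular_conj (g i) f hf)
  have hsur : Function.Surjective (fun x : ∀ i, G i => g i * x i * (g i)⁻¹) :=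
    (MulAut.conj (g i)).surjective.comp (Function.surjective_eval i)
  have h1 := fun θ => fracComap_comp (K := FunField k (∀ i, G i)) (L := FunField k (∀ i, G i))
    (M := FunField k (G i)) (regular_conj g) (MulAut.conj g).surjective (regular_proj G i)
    (Function.surjective_eval i) hreg hsur (fun x => rfl) θ
  have h2 := fun θ => fracComap_comp (K := FunField k (G i)) (L := FunField k (∀ i, G i))
    (M := FunField k (G i)) (regular_proj G i) (Function.surjective_eval i) (regular_conj (g i))
    (MulAut.conj (g i)).surjective hreg hsur (fun x => rfl) θ
  exact (h1 _).trans (h2 _).symm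

noncomputable instance piFieldFunField : Field (FunField k (∀ i, G i)) :=
  FractionRing.field _

set_option maxHeartbeats 1000000 in
theorem prodMap_isDominant {φ : ∀ i, RatMap k (G i) (LieAlg k (G i))} (hφ : ∀ i, (φ i).IsDominant) :
    (prodMap φ).IsDominant := by
  have h := injective_lift_of_single_proj (k := k) (X := G) (K := fun i => FunField k (G i))
    (E := FunField k (∀ i, G i)) (fun i => Function.surjective_eval i) (lieDualEquiv k G)
    (F := prodMap φ) (f := φ) (prodMap_lieDualEquiv_symm_single φ) hφ
  exact h

set_option maxHeartbeats 1000000 in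
theorem prodMap_degree (φ : ∀ i, RatMap k (G i) (LieAlg k (G i))) :
    (prodMap φ).degree = ∏ i, (φ i).degree := by
  have h := toENat_rank_adjoin_range_lift_of_single_proj (k := k) (X := G)
    (K := fun i => FunField k (G i)) (E := FunField k (∀ i, G i))
    (fun i => Function.surjective_eval i) (lieDualEquiv k G) (F := prodMap φ) (f := φ)
    (prodMap_lieDualEquiv_symm_single φ)
  exact h

end ProductMap

end CayleyDeg

/-! ### The theorem -/

theorem lemma2p1 {k : Type*} [Field k] [IsAlgClosed k] [CharZero k] :
    -- (a)
    (∀ {G H : Type*} [Group G] [Group H]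
      [CayleyDeg.LinearAlgebraicGroup k G] [CayleyDeg.LinearAlgebraicGroup k H]
      [CayleyDeg.ZariskiConnected k G] [CayleyDeg.ZariskiConnected k H]
      (π : G →* H), CayleyDeg.IsIsogeny k π → ∀ d : ℕ, Nat.card π.ker = d →
        CayleyDeg.cayleyDegree k G ≤ d * CayleyDeg.cayleyDegree k H ∧
        (¬ CayleyDeg.IsCayley k G → CayleyDeg.IsCayley k H → d = 2 →
          CayleyDeg.cayleyDegree k G = 2)) ∧
    -- (b)
    (∀ {n : ℕ} {G : Fin n → Type*} [∀ i, Group (G i)]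
      [∀ i, CayleyDeg.LinearAlgebraicGroup k (G i)] [∀ i, CayleyDeg.ZariskiConnected k (G i)]
      (φ : ∀ i, CayleyDeg.RatMap k (G i) (CayleyDeg.LieAlg k (G i))),
      (∀ i, CayleyDeg.IsGeneralizedCayleyMap (φ i)) →
        CayleyDeg.IsGeneralizedCayleyMap (CayleyDeg.prodMap φ) ∧
        (CayleyDeg.prodMap φ).degree = ∏ i, (φ i).degree) := by
  refine ⟨?_, ?_⟩
  · intro G H _ _ _ _ _ _ π hπ d hd
    subst hd
    have h := CayleyDeg.cayleyDegree_le_mul hπ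
    refine ⟨h, fun hG hH h2 => le_antisymm (h.trans ?_) (CayleyDeg.two_le_cayleyDegree k G hG)⟩
    rw [h2]
    exact (mul_le_mul_right (CayleyDeg.cayleyDegree_le_one k H hH) 2).trans_eq (mul_one 2)
  · intro n G _ _ _ φ hφ
    exact ⟨⟨CayleyDeg.prodMap_isEquivariant fun i => (hφ i).1,
      CayleyDeg.prodMap_isDominant fun i => (hφ i).2⟩, CayleyDeg.prodMap_degree φ⟩
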